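/- For real $x$ and an integer $k\ge 0$ let $\binom{x}{k}=\frac{x(x-1)\cdots(x-k+1)}{k!}$ if $x\ge k$ and $\binom{x}{k}=0$ if $x<k$. For an abelian group $G$ and real $x\ge 1$ let $\beta_G(x)=\max\{|H| : H\le G \text{ a finite subgroup with } |H|\le x\}$ (and $\beta_G(x)=0$ for $x<1$). Logarithms are in base $2$. **Theorem 1.5.** Let $m=m(n)$, $s=s(n)$ and $s'=s'(n)$ be sequences of positive integers, indexed by the integers $n\ge 1$, such that, as $n\to\infty$, $$s'=\Theta(s)\qquad\text{and}\qquad m=o\!\left(\frac{s^2}{(\log n)^2}\right),$$ and such that $s+s'\le m$ for every $n\ge 1$. Then there are functions $f,g:\mathbb N\to\mathbb R$, depending only on the sequences $m,s,s'$, with $f(n)=o(s(n))$ and $g(n)=o(m(n))$ as $n\to\infty$, such that the following holds for every $n\ge 1$, every abelian group $G$ and every $n$-element subset $Y\subseteq G$. The number of pairs $(A,B)$ of subsets of $Y$ with $|A|=s$, $|B|=s'$ and $|A+B|\le m$ is at most $$2^{f(n)}\binom{\frac{(m+\beta)s}{s+s'}}{s}\binom{\frac{(m+\beta)s'}{s+s'}}{s'},\qquad\text{where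 }\beta=\beta_G\big(m+g(n)\big).$$ -/

import Mathlib

open Filter Asymptotics
open scoped Pointwise

/-- The binomial coefficient `x (x - 1) ⋯ (x - k + 1) / k!` of a real number `x`,
with the convention that it is `0` when `x < k`. -/
noncomputable def realChoose (x : ℝ) (k : ℕ) : ℝ :=
  if (k : ℝ) ≤ x then (∏ i ∈ Finset.range k, (x - (i : ℝ))) / (k.factorial : ℝ) else 0

/-- The set of sizes of the finite subgroups of `G` with at most `x` elements. -/
def subgroupSizes (G : Type*) [AddCommGroup G] (x : ℝ) : Set ℕ :=
  {k | ∃ H : AddSubgroup G, (H : Set G).Finite ∧ (H : Set G).ncard = k ∧ (k : ℝ) ≤ x}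

/-- The size of the largest subgroup of `G` whose size is at most `x`
(it is only meaningful for `x ≥ 1`, when the trivial subgroup qualifies). -/
noncomputable def maxSubgroupSize (G : Type*) [AddCommGroup G] (x : ℝ) : ℕ :=
  sSup (subgroupSizes G x)

/-- For `x ≥ 1` the supremum is an attained maximum. -/
theorem maxSubgroupSize_isGreatest (G : Type*) [AddCommGroup G] {x : ℝ} (hx : 1 ≤ x) :
    IsGreatest (subgroupSizes G x) (maxSubgroupSize G x) := by
  have hbdd : BddAbove (subgroupSizes G x) := by
    refine ⟨⌊x⌋₊, ?_⟩
    rintro k ⟨H, -, -, hk⟩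
    exact Nat.le_floor hk
  have hne : (subgroupSizes G x).Nonempty := ⟨1, ⊥, by simp, by simp, by simpa using hx⟩
  exact ⟨Nat.sSup_mem hne hbdd, fun k hk => le_csSup hbdd hk⟩

/-- The pairs `(A, B)` of subsets of `Y` with `|A| = s`, `|B| = s'` and `|A + B| ≤ m`. -/
def smallSumsetPairs {G : Type*} [AddCommGroup G] [DecidableEq G] (Y : Finset G)
    (m s s' : ℕ) : Finset (Finset G × Finset G) :=
  (Y.powersetCard s ×ˢ Y.powersetCard s').filter fun p => (p.1 + p.2).card ≤ m

/-! The proof uses asymmetric containers. For fixed small ε it suffices to find 2^(o(s)) pairs (U,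
V) with |U| + |V| ≤ (1 + ε)m + β such that every counted (A, B) has A ⊆ U and B ⊆ V for one of them.
Each container then holds C(|U|, s) C(|V|, s') pairs. For a given total size this product is, up to
polynomial factors, largest when the sizes are proportional to s and s' (`choose_mul_choose_le`),
and removing the factor 1 + ε from the upper entries costs only exp(4√ε(s + s'))
(`realChoose_mul_le`).

The containers come from supersaturation. A Pollard-type inequality (`pollard_addSubgroup`), in
which subgroups are the only obstruction and β measures it, shows the following: if U and V have
size about m at most, but |U| + |V| exceeds the target, then a positive proportion of U × V has its
sum outside any given set D of size about m (`supersaturation`). Hence at most q elements of A and r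
elements of B determine a smaller pair that still contains (A, B), with |U||V| reduced by a constant
factor (`exists_containers_step`). After a first step that brings both sizes down to about m, a
number of steps depending only on ε suffices (`exists_containers`).

The fingerprints need qr to be at least a large constant times m, and they cost about (q + r) log n
bits. The choice q = r ≈ θs / log n meets both demands exactly because m = o(s² / (log n)²). Finally
ε tends to 0 slowly with n. -/

/-- The number of pairs in `U × V` whose sum lies outside `D`. -/
def numOutside {G : Type*} [AddCommGroup G] [DecidableEq G] (U V D : Finset G) : ℕ :=
  ((U ×ˢ V).filter fun p => p.1 + p.2 ∉ D).card

/-! ### Pollard's inequality in abelian groups, and supersaturation -/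

section Pollard

variable {G : Type*} [AddCommGroup G] [DecidableEq G]

lemma numOutside_eq_sum_left (U V D : Finset G) :
    numOutside U V D = ∑ u ∈ U, (V.filter fun v => u + v ∉ D).card := by
  simp only [numOutside, Finset.card_filter, Finset.sum_product]

lemma numOutside_comm (U V D : Finset G) : numOutside U V D = numOutside V U D := by
  simp only [numOutside, Finset.card_filter, Finset.sum_product]
  rw [Finset.sum_comm]
  simp only [add_comm]

lemma numOutside_union_left {U U' : Finset G} (h : Disjoint U U') (V D : Finset G) :
    numOutside (U ∪ U') V D = numOutside U V D + numOutside U' V D := by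
  simp only [numOutside_eq_sum_left, Finset.sum_union h]

lemma numOutside_union_right (U : Finset G) {V V' : Finset G} (h : Disjoint V V') (D : Finset G) :
    numOutside U (V ∪ V') D = numOutside U V D + numOutside U V' D := by
  rw [numOutside_comm, numOutside_union_left h, numOutside_comm V, numOutside_comm V']

lemma numOutside_vadd (U V D : Finset G) (x : G) :
    numOutside U (x +ᵥ V) (x +ᵥ D) = numOutside U V D := by
  rw [numOutside_eq_sum_left, numOutside_eq_sum_left]
  refine Finset.sum_congr rfl fun u _ => ?_
  refine (Finset.card_bij (fun v _ => x + v) ?_ (fun a _ b _ h => add_left_cancel h) ?_).symm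
  · intro v hv
    rw [Finset.mem_filter] at hv ⊢
    refine ⟨Finset.vadd_mem_vadd_finset hv.1, fun h => hv.2 ?_⟩
    rw [Finset.mem_vadd_finset] at h
    obtain ⟨d, hd, h⟩ := h
    rw [vadd_eq_add] at h
    have : d = u + v := by
      have : x + d = x + (u + v) := by rw [h]; abel
      exact add_left_cancel this
    rwa [← this]
  · intro w hw
    rw [Finset.mem_filter, Finset.mem_vadd_finset] at hw
    obtain ⟨⟨v, hv, rfl⟩, hw⟩ := hw
    refine ⟨v, ?_, rfl⟩
    rw [Finset.mem_filter]
    refine ⟨hv, fun h => hw ?_⟩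
    rw [Finset.mem_vadd_finset]
    exact ⟨_, h, by simp only [vadd_eq_add]; abel⟩

lemma le_card_add_card_filter (V D : Finset G) (u : G) :
    V.card ≤ D.card + (V.filter fun v => u + v ∉ D).card := by
  rw [← Finset.card_filter_add_card_filter_not (s := V) (fun v => u + v ∈ D)]
  refine Nat.add_le_add_right ?_ _
  refine Finset.card_le_card_of_injOn (fun v => u + v) (fun v hv => ?_)
    (fun a _ b _ h => add_left_cancel h)
  rw [Finset.mem_coe, Finset.mem_filter] at hv
  exact hv.2

/-- The trivial lower bound for the number of sums outside of `D`. -/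
lemma mul_card_le_numOutside {t : ℕ} {U : Finset G} (ht : t ≤ U.card) (V D : Finset G) :
    t * V.card ≤ t * D.card + numOutside U V D := by
  obtain h | h := le_total V.card D.card
  · exact (Nat.mul_le_mul_left t h).trans (Nat.le_add_right _ _)
  · have h1 : U.card * (V.card - D.card) ≤ numOutside U V D := by
      rw [numOutside_eq_sum_left, ← smul_eq_mul]
      refine Finset.card_nsmul_le_sum _ _ _ fun u _ => ?_
      have := le_card_add_card_filter V D u
      omega
    have h2 : t * (V.card - D.card) ≤ U.card * (V.card - D.card) := Nat.mul_le_mul_right _ ht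
    calc t * V.card = t * D.card + t * (V.card - D.card) := by
          rw [← mul_add]; congr 1; omega
      _ ≤ _ := by omega

/-- Cut U and V into common and private parts. The blocks of U × V regroup because swapping the
coordinates of (U ∩ V) × (V \ U) does not change the sums. This is Dyson's e-transform with
multiplicities. -/
lemma numOutside_eq_union_inter_add (U V D : Finset G) :
    numOutside U V D
      = numOutside (U ∪ V) (U ∩ V) D + numOutside (U \ V) (V \ U) D := by
  have hU : U = (U \ V) ∪ (U ∩ V) := by ext; simp; tauto
  have hV : V = (V \ U) ∪ (U ∩ V) := by ext; simp; tauto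
  have hUV : U ∪ V = ((U \ V) ∪ (U ∩ V)) ∪ (V \ U) := by ext; simp; tauto
  have d1 : Disjoint (U \ V) (U ∩ V) := by
    rw [Finset.disjoint_left]; intro x; simp; tauto
  have d2 : Disjoint (V \ U) (U ∩ V) := by
    rw [Finset.disjoint_left]; intro x; simp; tauto
  have d3 : Disjoint ((U \ V) ∪ (U ∩ V)) (V \ U) := by
    rw [Finset.disjoint_left]; intro x; simp; tauto
  have e1 : numOutside U V D = numOutside (U \ V) (V \ U) D + numOutside (U \ V) (U ∩ V) D
      + (numOutside (U ∩ V) (V \ U) D + numOutside (U ∩ V) (U ∩ V) D) := by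
    rw [← numOutside_union_right _ d2, ← numOutside_union_right _ d2,
      ← numOutside_union_left d1, ← hU, ← hV]
  have e2 : numOutside (U ∪ V) (U ∩ V) D = numOutside (U \ V) (U ∩ V) D
      + numOutside (U ∩ V) (U ∩ V) D + numOutside (V \ U) (U ∩ V) D := by
    conv_lhs => rw [hUV]
    rw [numOutside_union_left d3, numOutside_union_left d1]
  rw [e1, e2, numOutside_comm (V \ U) (U ∩ V)]
  ring

/-- If every translate of `V` that meets `U` lies in `U`, then `U` is invariant under a finite
subgroup which contains a translate of `V`. -/
lemma exists_addSubgroup_of_translates {U V : Finset G} (hU : U.Nonempty) (hV : V.Nonempty)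
    (h : ∀ x : G, (U ∩ (x +ᵥ V)).Nonempty → x +ᵥ V ⊆ U) :
    ∃ H : AddSubgroup G, (H : Set G).Finite ∧ V.card ≤ (H : Set G).ncard ∧
      (H : Set G).ncard ≤ U.card := by
  have key : ∀ u ∈ U, ∀ v ∈ V, ∀ w ∈ V, u + (w - v) ∈ U := by
    intro u hu v hv w hw
    have := h (u - v) ⟨u, Finset.mem_inter.2 ⟨hu, Finset.mem_vadd_finset.2 ⟨v, hv, by simp⟩⟩⟩
    exact this (Finset.mem_vadd_finset.2 ⟨w, hw, by simp only [vadd_eq_add]; abel⟩)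
  -- The stabilizer of U. By `key` it contains V - v, and translating it by a point of U embeds it
  -- into U.
  let H : AddSubgroup G :=
    { carrier := {x | ∀ u ∈ U, u + x ∈ U ∧ u - x ∈ U}
      zero_mem' := by simp
      add_mem' := by
        intro x y hx hy u hu
        refine ⟨?_, ?_⟩
        · rw [← add_assoc]; exact (hy _ (hx u hu).1).1
        · rw [← sub_sub]; exact (hy _ (hx u hu).2).2
      neg_mem' := by
        intro x hx u hu
        refine ⟨?_, ?_⟩
        · rw [← sub_eq_add_neg]; exact (hx u hu).2
        · rw [sub_neg_eq_add]; exact (hx u hu).1 }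
  obtain ⟨u, hu⟩ := hU
  obtain ⟨v, hv⟩ := hV
  have hmaps : Set.MapsTo (fun x => u + x) (H : Set G) (U : Set G) := fun x hx => (hx u hu).1
  have hinj : Set.InjOn (fun x => u + x) (H : Set G) := fun a _ b _ h => add_left_cancel h
  have hfin : (H : Set G).Finite := Set.Finite.of_injOn hmaps hinj U.finite_toSet
  refine ⟨H, hfin, ?_, ?_⟩
  · rw [← Set.ncard_coe_finset V]
    refine Set.ncard_le_ncard_of_injOn (fun w => w - v) ?_ (fun a _ b _ h => sub_left_injective h) hfin
    intro w hw u' hu'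
    refine ⟨key u' hu' v hv w hw, ?_⟩
    have := key u' hu' w hw v hv
    rwa [← neg_sub w v, ← sub_eq_add_neg] at this
  · rw [← Set.ncard_coe_finset U]
    exact Set.ncard_le_ncard_of_injOn _ hmaps hinj U.finite_toSet

/-- A version of Pollard's theorem for abelian groups. -/
theorem pollard_addSubgroup {M β : ℝ}
    (hβ : ∀ H : AddSubgroup G, (H : Set G).Finite → ((H : Set G).ncard : ℝ) ≤ M →
      ((H : Set G).ncard : ℝ) ≤ β) (hβ0 : 0 ≤ β) :
    ∀ (k : ℕ) (U V D : Finset G) (t : ℕ), V.card ≤ k → t ≤ U.card → t ≤ V.card →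
      -- When D is the set of sums with at least t representations, the right side is the sum of
      -- min(t, number of representations), as in Pollard's theorem. Allowing every D avoids having
      -- to name that set.
      (t : ℝ) * min ((U.card : ℝ) + V.card - t - β) M ≤ t * D.card + numOutside U V D := by
  intro k
  induction k with
  | zero =>
    intro U V D t hk _ ht
    have : t = 0 := by omega
    subst this
    simp
  | succ k ih =>
    intro U V D t hk htU htV
    obtain rfl | ht := Nat.eq_zero_or_pos t
    · simp
    have ht' : (0 : ℝ) < t := by exact_mod_cast ht
    -- If no translate of V meets U without lying inside it, there is a subgroup H with |V| ≤ |H| ≤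
    -- |U|. Either |H| ≤ M, so |V| ≤ β, or M < |U|; in both cases the trivial bound t|U| is enough.
    -- Otherwise a translate W is cut properly by U and the e-transform makes progress.
    by_cases hx : ∀ x : G, (U ∩ (x +ᵥ V)).Nonempty → x +ᵥ V ⊆ U
    · obtain ⟨H, hfin, hVH, hHU⟩ := exists_addSubgroup_of_translates
        (Finset.card_pos.1 (by omega)) (Finset.card_pos.1 (by omega)) hx
      have h1 : (t : ℝ) * U.card ≤ t * D.card + numOutside U V D := by
        rw [numOutside_comm]
        exact_mod_cast mul_card_le_numOutside htV U D
      refine le_trans (mul_le_mul_of_nonneg_left ?_ ht'.le) h1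
      have hVH' : (V.card : ℝ) ≤ (H : Set G).ncard := by exact_mod_cast hVH
      have hHU' : ((H : Set G).ncard : ℝ) ≤ U.card := by exact_mod_cast hHU
      by_cases hM : ((H : Set G).ncard : ℝ) ≤ M
      · refine (min_le_left _ _).trans ?_
        have := hβ H hfin hM
        linarith
      · refine (min_le_right _ _).trans ?_
        linarith
    · push Not at hx
      obtain ⟨x, hne, hns⟩ := hx
      set W := x +ᵥ V with hW
      have hWc : W.card = V.card := Finset.card_vadd_finset x V
      have hDc : (x +ᵥ D).card = D.card := Finset.card_vadd_finset x D
      rw [← numOutside_vadd U V D x, ← hW, numOutside_eq_union_inter_add, ← hDc, ← hWc]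
      set E := x +ᵥ D
      have hcard := Finset.card_union_add_card_inter U W
      have hlt : (U ∩ W).card < W.card := by
        refine Finset.card_lt_card ⟨Finset.inter_subset_right, fun h => hns ?_⟩
        exact fun y hy => (Finset.mem_inter.1 (h hy)).1
      have hpos : 0 < (U ∩ W).card := Finset.card_pos.2 hne
      have hcardR : ((U ∪ W).card : ℝ) + (U ∩ W).card = U.card + W.card := by exact_mod_cast hcard
      by_cases hi : t ≤ (U ∩ W).card
      · have := ih (U ∪ W) (U ∩ W) E t (by omega)
          (htU.trans (Finset.card_le_card Finset.subset_union_left)) hi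
        rw [hcardR] at this
        push_cast
        have h0 : (0 : ℝ) ≤ numOutside (U \ W) (W \ U) E := by positivity
        linarith
      · push Not at hi
        -- The intersection is too small to carry t = i + j + 1. The pair (U ∪ W, U ∩ W) takes the
        -- share i through the trivial bound, and the pair of differences takes j + 1 by induction,
        -- since i > 0 makes |W \ U| < |W|.
        obtain ⟨j, rfl⟩ := Nat.exists_eq_add_of_lt hi
        set i := (U ∩ W).card with hidef
        have c1 : (U \ W).card + i = U.card := Finset.card_sdiff_add_card_inter U W
        have c2 : (W \ U).card + i = W.card := by
          rw [hidef, Finset.inter_comm]; exact Finset.card_sdiff_add_card_inter W U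
        have h2 := ih (U \ W) (W \ U) E (j + 1) (by omega) (by omega) (by omega)
        have h1 : (i : ℝ) * (U ∪ W).card ≤ i * E.card + numOutside (U ∪ W) (U ∩ W) E := by
          rw [numOutside_comm]
          exact_mod_cast mul_card_le_numOutside le_rfl (U ∪ W) E
        have c1' : ((U \ W).card : ℝ) + i = U.card := by exact_mod_cast c1
        have c2' : ((W \ U).card : ℝ) + i = W.card := by exact_mod_cast c2
        have hi0 : (0 : ℝ) ≤ i := by positivity
        have hj0 : (0 : ℝ) ≤ j := by positivity
        push_cast at h2 ⊢
        set u : ℝ := (U.card : ℝ)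
        set w : ℝ := (W.card : ℝ)
        have e1 : ((U ∪ W).card : ℝ) = u + w - i := by linarith
        rw [e1] at h1
        have e2 : ((U \ W).card : ℝ) + (W \ U).card - (j + 1) - β
          = u + w - 2 * i - (j + 1) - β := by linarith
        rw [e2] at h2
        -- Relative to the wanted bound, the two estimates leave a surplus of at least iβ in the
        -- first case and i(u + w - i - M) in the second.
        rcases le_total (u + w - 2 * i - (j + 1) - β) M with hc | hc
        · rw [min_eq_left hc] at h2
          have := mul_le_mul_of_nonneg_left (min_le_left (u + w - (i + j + 1) - β) M)
            (by positivity : (0 : ℝ) ≤ i + j + 1)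
          nlinarith [mul_nonneg hi0 hβ0]
        · rw [min_eq_right hc] at h2
          have := mul_le_mul_of_nonneg_left (min_le_right (u + w - (i + j + 1) - β) M)
            (by positivity : (0 : ℝ) ≤ i + j + 1)
          nlinarith [mul_nonneg hi0 (by linarith : 0 ≤ u + w - i - M)]

/-- Many pairs of `U × V` have their sum outside of a set not much larger than `m`. -/
lemma supersaturation {ε β m : ℝ} (hε : 0 < ε) (hε1 : ε ≤ 1) (hβ0 : 0 ≤ β) (hm : 8 ≤ ε * m)
    (hβ : ∀ H : AddSubgroup G, (H : Set G).Finite → ((H : Set G).ncard : ℝ) ≤ (1 + ε) * m →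
      ((H : Set G).ncard : ℝ) ≤ β)
    {U V D : Finset G} (hU : (U.card : ℝ) ≤ (1 + ε / 4) * m) (hV : (V.card : ℝ) ≤ (1 + ε / 4) * m)
    (hUV : (1 + ε) * m + β ≤ U.card + V.card) (hD : (D.card : ℝ) ≤ (1 + ε / 4) * m) :
    ε ^ 2 / 32 * (U.card * V.card) ≤ numOutside U V D := by
  have hm0 : 0 < m := by
    by_contra h
    push Not at h
    nlinarith
  -- With this t the minimum in Pollard's inequality is at least (1 + 3ε/4)m, which beats |D| by
  -- εm/2.
  set t := ⌊ε * m / 4⌋₊ with ht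
  have ht1 : (t : ℝ) ≤ ε * m / 4 := Nat.floor_le (by positivity)
  have ht2 : ε * m / 8 ≤ t := by
    have := Nat.lt_floor_add_one (ε * m / 4)
    rw [← ht] at this
    linarith
  have htU : t ≤ U.card := by
    have : (t : ℝ) ≤ U.card := by nlinarith
    exact_mod_cast this
  have htV : t ≤ V.card := by
    have : (t : ℝ) ≤ V.card := by nlinarith
    exact_mod_cast this
  have key := pollard_addSubgroup hβ hβ0 V.card U V D t le_rfl htU htV
  have h1 : (1 + 3 * ε / 4) * m ≤ min ((U.card : ℝ) + V.card - t - β) ((1 + ε) * m) := by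
    refine le_min ?_ ?_
    · linarith
    · nlinarith
  have h2 : (t : ℝ) * (ε * m / 2) ≤ numOutside U V D := by
    have h3 : (t : ℝ) * ((1 + 3 * ε / 4) * m) ≤ t * D.card + numOutside U V D :=
      (mul_le_mul_of_nonneg_left h1 (by positivity)).trans key
    have h4 : (t : ℝ) * D.card ≤ t * ((1 + ε / 4) * m) :=
      mul_le_mul_of_nonneg_left hD (by positivity)
    nlinarith
  have h5 : ε * m / 8 * (ε * m / 2) ≤ t * (ε * m / 2) :=
    mul_le_mul_of_nonneg_right ht2 (by positivity)
  have h6 : (U.card : ℝ) * V.card ≤ (5 / 4 * m) * (5 / 4 * m) := by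
    refine mul_le_mul ?_ ?_ (by positivity) (by positivity)
    · nlinarith
    · nlinarith
  have h7 : ε ^ 2 / 32 * ((U.card : ℝ) * V.card) ≤ ε ^ 2 / 32 * ((5 / 4 * m) * (5 / 4 * m)) :=
    mul_le_mul_of_nonneg_left h6 (by positivity)
  have h8 : (0 : ℝ) ≤ ε ^ 2 * m ^ 2 := by positivity
  nlinarith

end Pollard

/-! ### Fingerprints of a pair with a small sumset -/

section Container

variable {G : Type*} [AddCommGroup G] [DecidableEq G]

/-- The elements of `V` with fewer than `c` sums with elements of `F` lying outside `D`. -/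
noncomputable def fewOutside (c : ℝ) (F V D : Finset G) : Finset G :=
  V.filter fun v => ((F.filter fun u => v + u ∉ D).card : ℝ) < c

lemma fewOutside_subset (c : ℝ) (F V D : Finset G) : fewOutside c F V D ⊆ V :=
  Finset.filter_subset _ _

/-- If many sums fall outside `D`, then `fewOutside` is a small part of `V`. -/
lemma card_fewOutside_le {c : ℝ} {F V D : Finset G} :
    (numOutside V F D : ℝ) ≤
      (fewOutside c F V D).card * c + ((V.card : ℝ) - (fewOutside c F V D).card) * F.card := by
  have hsplit := Finset.sum_filter_add_sum_filter_not V
    (fun v => ((F.filter fun u => v + u ∉ D).card : ℝ) < c)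
    (fun v => ((F.filter fun u => v + u ∉ D).card : ℝ))
  have hcard := Finset.card_filter_add_card_filter_not (s := V)
    (fun v => ((F.filter fun u => v + u ∉ D).card : ℝ) < c)
  rw [numOutside_eq_sum_left]
  push_cast
  rw [← hsplit]
  refine add_le_add ?_ ?_
  · rw [← nsmul_eq_mul]
    refine Finset.sum_le_card_nsmul _ _ _ fun v hv => ?_
    exact (Finset.mem_filter.1 hv).2.le
  · have : (V.card : ℝ) - (fewOutside c F V D).card
        = ((V.filter fun v => ¬ ((F.filter fun u => v + u ∉ D).card : ℝ) < c).card : ℝ) := by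
      rw [← hcard]
      simp [fewOutside]
    rw [this, ← nsmul_eq_mul]
    refine Finset.sum_le_card_nsmul _ _ _ fun v _ => ?_
    exact_mod_cast Finset.card_filter_le _ _

/-- A small fingerprint `F' ⊆ B` such that `F + F'` contains most of `F + b` for all `b ∈ B`. -/
lemma exists_fingerprint {c m : ℝ} {A B F V : Finset G} (hc : 0 < c)
    (hF : F ⊆ A) (hB : B ⊆ V) (hm : ((A + B).card : ℝ) ≤ m) :
    ∃ F' ⊆ B, c * F'.card ≤ m ∧ ((F + F').card : ℝ) ≤ m ∧ B ⊆ fewOutside c F V (F + F') := by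
  -- Take F' maximal such that its elements bring at least c new sums each on average. An element of
  -- B outside F' that brought c new sums could be added.
  obtain ⟨F', hF', hmax⟩ := Finset.exists_max_image
    (B.powerset.filter fun F' => c * F'.card ≤ (F + F').card) Finset.card
    ⟨∅, by simp⟩
  simp only [Finset.mem_filter, Finset.mem_powerset] at hF' hmax
  have hle : ((F + F').card : ℝ) ≤ m :=
    le_trans (by exact_mod_cast Finset.card_le_card (Finset.add_subset_add hF hF'.1)) hm
  refine ⟨F', hF'.1, hF'.2.trans hle, hle, fun b hb => ?_⟩
  rw [fewOutside, Finset.mem_filter]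
  refine ⟨hB hb, ?_⟩
  by_cases hbF : b ∈ F'
  · have : (F.filter fun u => b + u ∉ F + F') = ∅ := by
      rw [Finset.filter_eq_empty_iff]
      intro u hu h
      exact h (by rw [add_comm b u]; exact Finset.add_mem_add hu hbF)
    rw [this]
    simpa using hc
  · by_contra hcon
    push Not at hcon
    have hdisj : Disjoint (F + F') ((F.filter fun u => b + u ∉ F + F').image fun u => b + u) := by
      rw [Finset.disjoint_right]
      intro z hz
      obtain ⟨u, hu, rfl⟩ := Finset.mem_image.1 hz
      exact (Finset.mem_filter.1 hu).2
    have hsub : (F + F') ∪ ((F.filter fun u => b + u ∉ F + F').image fun u => b + u)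
        ⊆ F + insert b F' := by
      refine Finset.union_subset (Finset.add_subset_add_left (Finset.subset_insert _ _)) ?_
      intro z hz
      obtain ⟨u, hu, rfl⟩ := Finset.mem_image.1 hz
      simp only [add_comm b]
      exact Finset.add_mem_add (Finset.mem_filter.1 hu).1 (Finset.mem_insert_self _ _)
    have hcard := Finset.card_le_card hsub
    rw [Finset.card_union_of_disjoint hdisj,
      Finset.card_image_of_injective _ (add_right_injective b)] at hcard
    have hcard' : ((F + F').card : ℝ) + (F.filter fun u => b + u ∉ F + F').card
        ≤ (F + insert b F').card := by exact_mod_cast hcard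
    have := hmax (insert b F') ⟨Finset.insert_subset hb hF'.1, by
      rw [Finset.card_insert_of_notMem hbF]
      push_cast
      linarith [hF'.2]⟩
    rw [Finset.card_insert_of_notMem hbF] at this
    omega

/-- The number of representations of `z` as a sum of an element of `F` and one of `V`. -/
def reps (F V : Finset G) (z : G) : ℕ := (F.filter fun u => z - u ∈ V).card

/-- The elements with at least `t` representations. -/
def popular (t : ℕ) (F V : Finset G) : Finset G := (F + V).filter fun z => t ≤ reps F V z

lemma reps_eq_zero {F V : Finset G} {z : G} (h : z ∉ F + V) : reps F V z = 0 := by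
  rw [reps, Finset.card_eq_zero, Finset.filter_eq_empty_iff]
  intro u hu hz
  exact h (Finset.mem_add.2 ⟨u, hu, z - u, hz, by abel⟩)

lemma mem_popular {t : ℕ} (ht : 0 < t) {F V : Finset G} {z : G} :
    z ∈ popular t F V ↔ t ≤ reps F V z := by
  rw [popular, Finset.mem_filter, and_iff_right_iff_imp]
  intro h
  by_contra hz
  rw [reps_eq_zero hz] at h
  omega

lemma numOutside_eq_sum_reps (F V D : Finset G) :
    numOutside F V D = ∑ z ∈ (F + V) \ D, reps F V z := by
  rw [numOutside, Finset.card_eq_sum_card_fiberwise (f := fun p : G × G => p.1 + p.2)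
    (t := (F + V) \ D)]
  · refine Finset.sum_congr rfl fun z hz => ?_
    rw [Finset.mem_sdiff] at hz
    refine Finset.card_bij' (fun p _ => p.1) (fun u _ => (u, z - u)) ?_ ?_ ?_ ?_
    · rintro ⟨u, v⟩ h
      simp only [Finset.mem_filter, Finset.mem_product] at h ⊢
      refine ⟨h.1.1.1, ?_⟩
      rw [← h.2]
      simpa using h.1.1.2
    · intro u h
      simp only [Finset.mem_filter, Finset.mem_product] at h ⊢
      refine ⟨⟨h, ?_⟩, ?_⟩ <;> simp [hz.2]
    · rintro ⟨u, v⟩ h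
      simp only [Finset.mem_filter, Finset.mem_product] at h ⊢
      rw [← h.2]
      simp
    · intro u h
      rfl
  · rintro ⟨u, v⟩ h
    simp only [Finset.coe_filter, Finset.mem_product, Set.mem_ofPred_eq] at h
    simp only [Finset.coe_sdiff, Set.mem_sdiff, Finset.mem_coe]
    exact ⟨Finset.add_mem_add h.1.1 h.1.2, h.2⟩

lemma reps_insert {F V : Finset G} {a : G} (ha : a ∉ F) (z : G) :
    reps (insert a F) V z = reps F V z + if z - a ∈ V then 1 else 0 := by
  rw [reps, reps, Finset.filter_insert]
  split_ifs with h
  · rw [Finset.card_insert_of_notMem]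
    simp [ha]
  · rfl

/-- The number of representations, truncated at `t` and summed over all of `Z`. -/
def cappedReps (t : ℕ) (F V Z : Finset G) : ℕ := ∑ z ∈ Z, min (reps F V z) t

lemma cappedReps_le (t : ℕ) (F V Z D : Finset G) :
    cappedReps t F V Z ≤ t * D.card + numOutside F V D := by
  rw [cappedReps, ← Finset.sum_filter_add_sum_filter_not Z (· ∈ D)]
  refine add_le_add ?_ ?_
  · calc ∑ z ∈ Z.filter (· ∈ D), min (reps F V z) t ≤ ∑ z ∈ D, t := by
          refine (Finset.sum_le_sum fun z _ => min_le_right _ _).trans ?_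
          exact Finset.sum_le_sum_of_subset fun z hz => (Finset.mem_filter.1 hz).2
      _ = _ := by simp [mul_comm]
  · rw [numOutside_eq_sum_reps]
    refine (Finset.sum_le_sum fun z _ => min_le_left _ _).trans ?_
    rw [← Finset.sum_filter_ne_zero]
    refine Finset.sum_le_sum_of_subset fun z hz => ?_
    simp only [Finset.mem_filter] at hz
    rw [Finset.mem_sdiff]
    refine ⟨?_, hz.1.2⟩
    by_contra h
    exact hz.2 (reps_eq_zero h)

/-- A value a + v that is not yet popular is below the cap, so the new representation raises its
truncated count by one. -/
lemma cappedReps_insert {t : ℕ} (ht : 0 < t) {F V Z : Finset G} {a : G} (ha : a ∉ F)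
    (hZ : ∀ v ∈ V, a + v ∈ Z) :
    cappedReps t F V Z + (V.filter fun v => a + v ∉ popular t F V).card
      ≤ cappedReps t (insert a F) V Z := by
  have h1 : (V.filter fun v => a + v ∉ popular t F V).card
      ≤ ∑ z ∈ Z, if z - a ∈ V ∧ reps F V z < t then 1 else 0 := by
    rw [← Finset.card_filter]
    refine Finset.card_le_card_of_injOn (fun v => a + v) ?_ (fun a _ b _ h => add_left_cancel h)
    intro v hv
    simp only [Finset.coe_filter, Set.mem_ofPred_eq, mem_popular ht, not_le] at hv ⊢
    exact ⟨hZ v hv.1, by simpa using hv.1, hv.2⟩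
  refine (Nat.add_le_add_left h1 _).trans ?_
  rw [cappedReps, cappedReps, ← Finset.sum_add_distrib]
  refine Finset.sum_le_sum fun z _ => ?_
  rw [reps_insert ha]
  split_ifs <;> first | omega | tauto

/-- Either `A` lies in a small container or it has a fingerprint with many sums outside of every
small set. -/
lemma exists_left_fingerprint {δ γ m : ℝ} {q t : ℕ} {A U V : Finset G}
    (ht : 0 < t) (hγ1 : γ ≤ 1) (hδ : 0 < δ)
    (hγ : 0 < γ) (htq : 8 * m * t ≤ 2 * (δ * q * V.card)) (htq' : δ * q * V.card ≤ 8 * m * t)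
    (hA : A ⊆ U) :
    ∃ F ⊆ A, F.card ≤ q ∧
      ((((popular t F V).card : ℝ) ≤ (1 + γ) * m ∧
          A ⊆ fewOutside (δ / 2 * V.card) V U (popular t F V) ∪ F) ∨
        ∀ D : Finset G, (D.card : ℝ) ≤ m → γ * δ / 8 * q * V.card ≤ numOutside F V D) := by
  -- Again a maximal choice, now bounded by q and measured by truncated counts. If F stops before
  -- reaching q, every other element of A has few sums outside the popular set. If |F| = q, the
  -- truncated count is too large to fit into a set D of size m, because tm ≤ δq|V|/4.
  obtain ⟨F, hF, hmax⟩ := Finset.exists_max_image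
    (A.powerset.filter fun F => F.card ≤ q ∧
      δ / 2 * V.card * F.card ≤ cappedReps t F V (A + V)) Finset.card ⟨∅, by simp⟩
  simp only [Finset.mem_filter, Finset.mem_powerset] at hF hmax
  obtain ⟨hFA, hFq, hFc⟩ := hF
  refine ⟨F, hFA, hFq, ?_⟩
  have hpos : 0 ≤ δ * q * V.card := by positivity
  by_cases hover : ((popular t F V).card : ℝ) ≤ (1 + γ) * m
  · obtain hlt | heq := hFq.lt_or_eq
    · refine Or.inl ⟨hover, fun a ha => ?_⟩
      rw [Finset.mem_union]
      by_cases haF : a ∈ F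
      · exact Or.inr haF
      · left
        rw [fewOutside, Finset.mem_filter]
        refine ⟨hA ha, ?_⟩
        by_contra hcon
        push Not at hcon
        have h1 := cappedReps_insert ht haF (V := V) (Z := A + V)
          fun v hv => Finset.add_mem_add ha hv
        have h1' : (cappedReps t F V (A + V) : ℝ) + (V.filter fun v => a + v ∉ popular t F V).card
          ≤ cappedReps t (insert a F) V (A + V) := by exact_mod_cast h1
        have := hmax (insert a F) ⟨Finset.insert_subset ha hFA, by
          rw [Finset.card_insert_of_notMem haF]; omega, by
          rw [Finset.card_insert_of_notMem haF]
          push_cast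
          linarith⟩
        rw [Finset.card_insert_of_notMem haF] at this
        omega
    · right
      intro D hD
      have h1 : (cappedReps t F V (A + V) : ℝ) ≤ t * D.card + numOutside F V D := by
        exact_mod_cast cappedReps_le t F V (A + V) D
      rw [heq] at hFc
      have h2 : (t : ℝ) * D.card ≤ t * m := mul_le_mul_of_nonneg_left hD (by positivity)
      have h3 : γ * (δ * q * V.card) ≤ 1 * (δ * q * V.card) :=
        mul_le_mul_of_nonneg_right hγ1 hpos
      linarith
  -- More than (1 + γ)m popular values: over γm of them avoid D, each with at least t
  -- representations.
  · right
    intro D hD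
    push Not at hover
    have h1 : t * ((popular t F V).card - D.card) ≤ numOutside F V D := by
      rw [numOutside_eq_sum_reps]
      calc t * ((popular t F V).card - D.card) ≤ t * (popular t F V \ D).card :=
            Nat.mul_le_mul_left _ (Finset.le_card_sdiff _ _)
        _ = ∑ z ∈ popular t F V \ D, t := by simp [mul_comm]
        _ ≤ ∑ z ∈ popular t F V \ D, reps F V z := by
            refine Finset.sum_le_sum fun z hz => ?_
            exact (mem_popular ht).1 (Finset.mem_sdiff.1 hz).1
        _ ≤ _ := Finset.sum_le_sum_of_subset
            (Finset.sdiff_subset_sdiff (Finset.filter_subset _ _) le_rfl)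
    have h2 : (t : ℝ) * ((popular t F V).card - D.card) ≤ numOutside F V D := by
      have h5 : ((popular t F V).card : ℝ) ≤ ((popular t F V).card - D.card : ℕ) + D.card := by
        exact_mod_cast (by omega :
          (popular t F V).card ≤ ((popular t F V).card - D.card) + D.card)
      have h6 : (t : ℝ) * ((popular t F V).card - D.card : ℕ) ≤ numOutside F V D := by
        exact_mod_cast h1
      exact (mul_le_mul_of_nonneg_left (by linarith) (by positivity)).trans h6
    have h3 : (t : ℝ) * (γ * m) ≤ t * ((popular t F V).card - D.card) :=
      mul_le_mul_of_nonneg_left (by linarith) (by positivity)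
    have h4 : γ * (δ * q * V.card) ≤ γ * (8 * m * t) := mul_le_mul_of_nonneg_left htq' hγ.le
    linarith

end Container

/-! ### The container algorithm -/

section Iterate

/-- The subsets of `Y` with at most `k` elements. -/
def smallSubsets {α : Type*} (Y : Finset α) (k : ℕ) : Finset (Finset α) :=
  Y.powerset.filter fun F => F.card ≤ k

lemma mem_smallSubsets {α : Type*} {Y F : Finset α} {k : ℕ} :
    F ∈ smallSubsets Y k ↔ F ⊆ Y ∧ F.card ≤ k := by
  simp [smallSubsets]

lemma card_smallSubsets_le {α : Type*} [DecidableEq α] (Y : Finset α) (k : ℕ) :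
    (smallSubsets Y k).card ≤ (Y.card + 1) ^ k := by
  induction k with
  | zero =>
    have : smallSubsets Y 0 = {∅} := by
      ext F
      rw [mem_smallSubsets, Finset.mem_singleton, Nat.le_zero, Finset.card_eq_zero]
      exact ⟨fun h => h.2, fun h => ⟨by simp [h], h⟩⟩
    simp [this]
  | succ k ih =>
    have hsub : smallSubsets Y (k + 1) ⊆ smallSubsets Y k ∪ Y.powersetCard (k + 1) := by
      intro F hF
      rw [mem_smallSubsets] at hF
      rw [Finset.mem_union, mem_smallSubsets, Finset.mem_powersetCard]
      rcases Nat.lt_or_ge k F.card with h | h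
      · exact Or.inr ⟨hF.1, by omega⟩
      · exact Or.inl ⟨hF.1, h⟩
    calc (smallSubsets Y (k + 1)).card
        ≤ (smallSubsets Y k).card + (Y.powersetCard (k + 1)).card :=
          (Finset.card_le_card hsub).trans (Finset.card_union_le _ _)
      _ ≤ (Y.card + 1) ^ k + Y.card ^ (k + 1) := by
          rw [Finset.card_powersetCard]
          exact add_le_add ih (Nat.choose_le_pow _ _)
      _ ≤ (Y.card + 1) ^ k + (Y.card + 1) ^ k * Y.card := by
          rw [pow_succ]
          gcongr
          omega
      _ = _ := by ring

variable {G : Type*} [AddCommGroup G] [DecidableEq G]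

/-- Every pair `(A, B)` of subsets of `U` and `V` whose sumset has at most `m` elements lies in
one of the pairs in `C`. -/
def CoversPairs (C : Finset (Finset G × Finset G)) (U V : Finset G) (m : ℝ) : Prop :=
  ∀ A ⊆ U, ∀ B ⊆ V, ((A + B).card : ℝ) ≤ m → ∃ p ∈ C, A ⊆ p.1 ∧ B ⊆ p.2

/-- Kept elements contribute at most κb outside sums each and discarded ones at most b, so a total
of 2κb|V| forces at least κ|V| elements to be discarded. -/
lemma card_fewOutside_le_of_numOutside {κ a b : ℝ} {F V D : Finset G} (hκ : 0 ≤ κ) (hκ1 : κ < 1)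
    (hb : 0 < b) (hF : (F.card : ℝ) ≤ b) (h : 2 * κ * b * V.card ≤ numOutside V F D)
    (ha : a = κ * b) :
    ((fewOutside a F V D).card : ℝ) ≤ (1 - κ) * V.card := by
  have h1 := h.trans (card_fewOutside_le (c := a))
  have hx : ((fewOutside a F V D).card : ℝ) ≤ V.card := by
    exact_mod_cast Finset.card_le_card (fewOutside_subset _ _ _ _)
  set x : ℝ := ((fewOutside a F V D).card : ℝ)
  have h2 : ((V.card : ℝ) - x) * F.card ≤ (V.card - x) * b :=
    mul_le_mul_of_nonneg_left hF (by linarith)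
  have h3 : b * (2 * κ * V.card) ≤ b * (x * κ + (V.card - x)) := by
    rw [ha] at h1
    nlinarith
  have h4 := le_of_mul_le_mul_left h3 hb
  have hV : (0 : ℝ) ≤ V.card := by positivity
  have h5 : (1 - κ) * x ≤ (1 - κ) * ((1 - κ) * V.card) := by
    nlinarith [mul_nonneg (mul_nonneg hκ hκ) hV]
  exact le_of_mul_le_mul_left h5 (by linarith)

/-- A single step of the container algorithm. -/
lemma exists_containers_step {δ γ m : ℝ} {q t r : ℕ} {Y U V : Finset G}
    (hδ : 0 < δ) (hδ1 : δ ≤ 1) (hγ : 0 < γ) (hγ1 : γ ≤ 1) (hq : 0 < q) (ht : 0 < t)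
    (hU : U ⊆ Y) (hV : V ⊆ Y)
    (htq : 8 * m * t ≤ 2 * (δ * q * V.card)) (htq' : δ * q * V.card ≤ 8 * m * t)
    (hqU : (q : ℝ) ≤ δ / 4 * U.card) (hr : m ≤ γ * δ / 16 * q * r)
    (hsat : ∀ D : Finset G, (D.card : ℝ) ≤ (1 + γ) * m →
      δ * (U.card * V.card) ≤ numOutside U V D) :
    ∃ C : Finset (Finset G × Finset G), C.card ≤ 2 * (Y.card + 1) ^ (q + r) ∧
      (∀ p ∈ C, p.1 ⊆ U ∧ p.2 ⊆ V ∧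
        ((p.1.card : ℝ) * p.2.card) ≤ (1 - γ * δ / 16) * (U.card * V.card)) ∧
      CoversPairs C U V m := by
  classical
  have hγδ : γ * δ ≤ 1 := mul_le_one₀ hγ1 hδ.le hδ1
  have hγδ0 : 0 < γ * δ := mul_pos hγ hδ
  have hγδδ : γ * δ ≤ δ := mul_le_of_le_one_left hδ.le hγ1
  have hq' : (0 : ℝ) < q := by exact_mod_cast hq
  -- The two outcomes of the left fingerprint: `φ` shrinks U using F alone, while `ψ` shrinks V
  -- using F and a second fingerprint in B. Both depend only on the fingerprints, so they can be
  -- enumerated without knowing A and B.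
  let φ : Finset G → Finset G × Finset G := fun F =>
    (fewOutside (δ / 2 * V.card) V U (popular t F V) ∪ F, V)
  let ψ : Finset G × Finset G → Finset G × Finset G := fun p =>
    (U, fewOutside (γ * δ / 16 * q) p.1 V (p.1 + p.2))
  let C₀ := (smallSubsets Y q).image φ ∪ (smallSubsets Y q ×ˢ smallSubsets Y r).image ψ
  refine ⟨C₀.filter fun p => p.1 ⊆ U ∧ p.2 ⊆ V ∧
    ((p.1.card : ℝ) * p.2.card) ≤ (1 - γ * δ / 16) * (U.card * V.card), ?_, ?_, ?_⟩
  · refine (Finset.card_filter_le _ _).trans ((Finset.card_union_le _ _).trans ?_)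
    have h1 : ((smallSubsets Y q).image φ).card ≤ (Y.card + 1) ^ (q + r) :=
      Finset.card_image_le.trans ((card_smallSubsets_le Y q).trans
        (Nat.pow_le_pow_right (by omega) (by omega)))
    have h2 : ((smallSubsets Y q ×ˢ smallSubsets Y r).image ψ).card ≤ (Y.card + 1) ^ (q + r) := by
      refine Finset.card_image_le.trans ?_
      rw [Finset.card_product, pow_add]
      exact Nat.mul_le_mul (card_smallSubsets_le Y q) (card_smallSubsets_le Y r)
    omega
  · intro p hp
    exact (Finset.mem_filter.1 hp).2
  · intro A hA B hB hm
    obtain ⟨F, hFA, hFq, h | h⟩ := exists_left_fingerprint ht hγ1 hδ hγ htq htq' hA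
    · refine ⟨φ F, ?_, h.2, hB⟩
      refine Finset.mem_filter.2 ⟨Finset.mem_union_left _ (Finset.mem_image_of_mem _
        (mem_smallSubsets.2 ⟨hFA.trans (hA.trans hU), hFq⟩)), ?_, Finset.Subset.refl _, ?_⟩
      · exact Finset.union_subset (fewOutside_subset _ _ _ _) (hFA.trans hA)
      · have hs := hsat _ h.1
        obtain hV0 | hV0 := Nat.eq_zero_or_pos V.card
        · simp [φ, hV0]
        · have hV0' : (0 : ℝ) < V.card := by exact_mod_cast hV0
          have h1 := card_fewOutside_le_of_numOutside (a := δ / 2 * V.card) (b := V.card)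
            (by positivity : 0 ≤ δ / 2) (by linarith) hV0' le_rfl
            (by linarith : 2 * (δ / 2) * V.card * U.card ≤ (numOutside U V (popular t F V) : ℝ)) rfl
          have h2 : ((φ F).1.card : ℝ) ≤
              (fewOutside (δ / 2 * V.card) V U (popular t F V)).card + F.card := by
            exact_mod_cast Finset.card_union_le _ _
          have h3 : (F.card : ℝ) ≤ q := by exact_mod_cast hFq
          have hU0 : (0 : ℝ) ≤ U.card := by positivity
          have h4 : ((φ F).1.card : ℝ) ≤ (1 - γ * δ / 16) * U.card := by nlinarith
          calc ((φ F).1.card : ℝ) * V.card ≤ (1 - γ * δ / 16) * U.card * V.card :=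
                mul_le_mul_of_nonneg_right h4 hV0'.le
            _ = _ := by ring
    · obtain ⟨F', hF'B, hF'm, hD, hBF⟩ := exists_fingerprint (c := γ * δ / 16 * q) (V := V)
        (by positivity) hFA hB hm
      have hF'r : F'.card ≤ r := by
        have : γ * δ / 16 * q * F'.card ≤ γ * δ / 16 * q * r := hF'm.trans hr
        exact_mod_cast le_of_mul_le_mul_left this (by positivity)
      refine ⟨ψ (F, F'), ?_, hA, hBF⟩
      refine Finset.mem_filter.2 ⟨Finset.mem_union_right _ (Finset.mem_image_of_mem _
        (Finset.mem_product.2 ⟨mem_smallSubsets.2 ⟨hFA.trans (hA.trans hU), hFq⟩,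
          mem_smallSubsets.2 ⟨hF'B.trans (hB.trans hV), hF'r⟩⟩)), Finset.Subset.refl _,
          fewOutside_subset _ _ _ _, ?_⟩
      have hs := h _ hD
      rw [numOutside_comm] at hs
      have h1 := card_fewOutside_le_of_numOutside (κ := γ * δ / 16) (a := γ * δ / 16 * q) (b := q)
        (by positivity) (by linarith) hq' (by exact_mod_cast hFq)
        (by linarith : 2 * (γ * δ / 16) * q * V.card ≤ (numOutside V F (F + F') : ℝ)) rfl
      calc (U.card : ℝ) * (fewOutside (γ * δ / 16 * q) F V (F + F')).card
          ≤ U.card * ((1 - γ * δ / 16) * V.card) :=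
            mul_le_mul_of_nonneg_left h1 (by positivity)
        _ = _ := by ring

/-- The container algorithm, started from sets that are not much larger than `m`. -/
lemma exists_containers_of_card_le {ε β m : ℝ} {q r : ℕ} {Y : Finset G}
    (hε : 0 < ε) (hε1 : ε ≤ 1) (hβ0 : 0 ≤ β)
    (hβ : ∀ H : AddSubgroup G, (H : Set G).Finite → ((H : Set G).ncard : ℝ) ≤ (1 + ε) * m →
      ((H : Set G).ncard : ℝ) ≤ β)
    (hq : 1024 ≤ ε ^ 3 * q) (hqm : q ≤ ε ^ 3 / 512 * m) (hr : m ≤ ε ^ 3 / 2048 * q * r) (k : ℕ) :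
    ∀ U ⊆ Y, ∀ V ⊆ Y, (U.card : ℝ) ≤ (1 + ε / 4) * m → (V.card : ℝ) ≤ (1 + ε / 4) * m →
      (1 - ε ^ 3 / 2048) ^ k * (U.card * V.card) < (3 * ε / 4 * m) ^ 2 →
      ∃ C : Finset (Finset G × Finset G), C.card ≤ (2 * (Y.card + 1) ^ (q + r)) ^ k ∧
        (∀ p ∈ C, (p.1.card : ℝ) + p.2.card ≤ (1 + ε) * m + β) ∧ CoversPairs C U V m := by
  have hε3 : ε ^ 3 ≤ 1 := pow_le_one₀ hε.le hε1
  have hε3' : 0 < ε ^ 3 := by positivity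
  have hq1 : (1024 : ℝ) ≤ q := by
    have : (0 : ℝ) ≤ q := by positivity
    nlinarith
  have hm8 : 8 ≤ ε * m := by
    have : ε ^ 3 ≤ ε := by
      calc ε ^ 3 ≤ ε ^ 1 := pow_le_pow_of_le_one hε.le hε1 (by norm_num)
        _ = ε := pow_one ε
    have hm : 0 < m := by
      by_contra h
      push Not at h
      nlinarith
    nlinarith
  have hm : 0 < m := by
    by_contra h
    push Not at h
    nlinarith
  have hself : ∀ U V : Finset G, CoversPairs {(U, V)} U V m := by
    intro U V A hA B hB _
    exact ⟨(U, V), by simp, hA, hB⟩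
  induction k with
  | zero =>
    intro U hU V hV hUm hVm hlt
    refine ⟨{(U, V)}, by simp, ?_, hself U V⟩
    · intro p hp
      rw [Finset.mem_singleton] at hp
      subst hp
      -- A pair above the target has both sizes at least 3εm/4, because neither exceeds (1 + ε/4)m.
      -- This contradicts the bound on the product, so the algorithm has already stopped.
      by_contra hcon
      push Not at hcon
      dsimp only at hcon
      have h1 : 3 * ε / 4 * m ≤ U.card := by linarith
      have h2 : 3 * ε / 4 * m ≤ V.card := by linarith
      have := mul_le_mul h1 h2 (by positivity) (by positivity)
      nlinarith
  | succ k ih =>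
    intro U hU V hV hUm hVm hlt
    by_cases hcon : (U.card : ℝ) + V.card ≤ (1 + ε) * m + β
    · refine ⟨{(U, V)}, ?_, ?_, hself U V⟩
      · rw [Finset.card_singleton]
        exact Nat.one_le_pow _ _ (by positivity)
      · intro p hp
        rw [Finset.mem_singleton] at hp
        subst hp
        exact hcon
    · push Not at hcon
      have h1 : 3 * ε / 4 * m ≤ U.card := by linarith
      have h2 : 3 * ε / 4 * m ≤ V.card := by linarith
      -- The threshold t of the step is ⌈x⌉. As x ≥ 1, rounding up at most doubles it, which is the
      -- slack between the two conditions on t.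
      set x : ℝ := ε ^ 2 / 32 * q * V.card / (8 * m) with hx
      have hx1 : 1 ≤ x := by
        rw [hx, le_div_iff₀ (by positivity)]
        have : ε ^ 2 / 32 * q * (3 * ε / 4 * m) ≤ ε ^ 2 / 32 * q * V.card :=
          mul_le_mul_of_nonneg_left h2 (by positivity)
        nlinarith
      have hxm : 8 * m * x = ε ^ 2 / 32 * q * V.card := by
        rw [hx]; field_simp
      have hc1 := Nat.le_ceil x
      have hc2 := Nat.ceil_lt_add_one (zero_le_one.trans hx1)
      have hm8' : 0 < 8 * m := by positivity
      obtain ⟨C₁, hC₁, hC₁p, hC₁c⟩ := exists_containers_step (δ := ε ^ 2 / 32) (γ := ε / 4)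
        (m := m) (q := q) (t := ⌈x⌉₊) (r := r) (by positivity)
        (by nlinarith) (by positivity) (by linarith) (by
          have : (0 : ℝ) < q := by linarith
          exact_mod_cast this) (Nat.ceil_pos.2 (by linarith)) hU hV
        (by
          rw [← hxm]
          have : 8 * m * (⌈x⌉₊ : ℝ) ≤ 8 * m * (2 * x) :=
            mul_le_mul_of_nonneg_left (by linarith) hm8'.le
          linarith)
        (by rw [← hxm]; exact mul_le_mul_of_nonneg_left hc1 hm8'.le)
        (by
          have : ε ^ 2 / 32 / 4 * (3 * ε / 4 * m) ≤ ε ^ 2 / 32 / 4 * U.card :=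
            mul_le_mul_of_nonneg_left h1 (by positivity)
          nlinarith [mul_pos hε3' hm])
        (by
          have : ε / 4 * (ε ^ 2 / 32) / 16 = ε ^ 3 / 2048 := by ring
          rw [this]; exact hr)
        (fun D hD => supersaturation hε hε1 hβ0 hm8 hβ hUm hVm hcon.le hD)
      have hκ : ε / 4 * (ε ^ 2 / 32) / 16 = ε ^ 3 / 2048 := by ring
      rw [hκ] at hC₁p
      have hchild : ∀ p ∈ C₁, ∃ C : Finset (Finset G × Finset G),
          C.card ≤ (2 * (Y.card + 1) ^ (q + r)) ^ k ∧
          (∀ p ∈ C, (p.1.card : ℝ) + p.2.card ≤ (1 + ε) * m + β) ∧ CoversPairs C p.1 p.2 m := by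
        intro p hp
        obtain ⟨hp1, hp2, hp3⟩ := hC₁p p hp
        refine ih p.1 (hp1.trans hU) p.2 (hp2.trans hV) ?_ ?_ ?_
        · exact le_trans (by exact_mod_cast Finset.card_le_card hp1) hUm
        · exact le_trans (by exact_mod_cast Finset.card_le_card hp2) hVm
        · refine lt_of_le_of_lt ?_ hlt
          rw [pow_succ _ k, mul_assoc]
          exact mul_le_mul_of_nonneg_left hp3 (pow_nonneg (by linarith) _)
      choose! Φ hΦ using hchild
      refine ⟨C₁.biUnion Φ, ?_, ?_, ?_⟩
      · rw [pow_succ']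
        refine (Finset.card_biUnion_le_card_mul _ _ _ fun p hp => (hΦ p hp).1).trans ?_
        exact Nat.mul_le_mul_right _ hC₁
      · intro p hp
        obtain ⟨p', hp', hpp⟩ := Finset.mem_biUnion.1 hp
        exact (hΦ p' hp').2.1 p hpp
      · intro A hA B hB hAB
        obtain ⟨p, hp, hpA, hpB⟩ := hC₁c A hA B hB hAB
        obtain ⟨p', hp', h⟩ := (hΦ p hp).2.2 A hpA B hpB hAB
        exact ⟨p', Finset.mem_biUnion.2 ⟨p, hp, hp'⟩, h⟩

/-- Count F × W with W the kept set: every element of W has at least |F| - c sums in D, and every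
element of F has at most |D|. -/
lemma card_fewOutside_mul_le (c : ℝ) (F V D : Finset G) :
    ((fewOutside c F V D).card : ℝ) * (F.card - c) ≤ D.card * F.card := by
  set W := fewOutside c F V D with hW
  have h1 : (F.card : ℝ) * W.card ≤ F.card * D.card + numOutside F W D := by
    exact_mod_cast mul_card_le_numOutside le_rfl W D
  have h2 : (numOutside F W D : ℝ) ≤ W.card * c := by
    rw [numOutside_comm, numOutside_eq_sum_left, ← nsmul_eq_mul]
    push_cast
    refine Finset.sum_le_card_nsmul _ _ _ fun v hv => ?_
    rw [hW, fewOutside, Finset.mem_filter] at hv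
    exact hv.2.le
  linarith

/-- The container theorem for pairs of sets with a small sumset. -/
theorem exists_containers {ε β m : ℝ} {q r k s s' : ℕ} {Y : Finset G}
    (hε : 0 < ε) (hε1 : ε ≤ 1) (hβ0 : 0 ≤ β)
    (hβ : ∀ H : AddSubgroup G, (H : Set G).Finite → ((H : Set G).ncard : ℝ) ≤ (1 + ε) * m →
      ((H : Set G).ncard : ℝ) ≤ β)
    (hq : 1024 ≤ ε ^ 3 * q) (hqm : q ≤ ε ^ 3 / 512 * m) (hr : m ≤ ε ^ 3 / 2048 * q * r)
    (hk : 25 * (1 - ε ^ 3 / 2048) ^ k < 9 * ε ^ 2) (hqs : q ≤ s) (hqs' : q ≤ s') :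
    ∃ C : Finset (Finset G × Finset G), C.card ≤ (2 * (Y.card + 1) ^ (q + r)) ^ (k + 2) ∧
      (∀ p ∈ C, (p.1.card : ℝ) + p.2.card ≤ (1 + ε) * m + β) ∧
      ∀ A ⊆ Y, ∀ B ⊆ Y, A.card = s → B.card = s' → ((A + B).card : ℝ) ≤ m →
        ∃ p ∈ C, A ⊆ p.1 ∧ B ⊆ p.2 := by
  classical
  have hε3 : ε ^ 3 ≤ 1 := pow_le_one₀ hε.le hε1
  have hε3' : 0 < ε ^ 3 := by positivity
  have hq1 : (1024 : ℝ) ≤ q := by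
    have : (0 : ℝ) ≤ q := by positivity
    nlinarith
  have hm : 0 < m := by
    by_contra h
    push Not at h
    nlinarith
  let P : Finset (Finset G × Finset G) := smallSubsets Y q ×ˢ smallSubsets Y r
  have hP : P.card ≤ (Y.card + 1) ^ (q + r) := by
    rw [Finset.card_product, pow_add]
    exact Nat.mul_le_mul (card_smallSubsets_le Y q) (card_smallSubsets_le Y r)
  let κ : Finset G × Finset G → Finset G := fun p => fewOutside (ε / 8 * q) p.1 Y (p.1 + p.2)
  let S : Finset ((Finset G × Finset G) × (Finset G × Finset G)) :=
    (P ×ˢ P).filter fun x => ((κ x.1).card : ℝ) ≤ (1 + ε / 4) * m ∧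
      ((κ x.2).card : ℝ) ≤ (1 + ε / 4) * m
  have hchild : ∀ x ∈ S, ∃ C : Finset (Finset G × Finset G),
      C.card ≤ (2 * (Y.card + 1) ^ (q + r)) ^ k ∧
      (∀ p ∈ C, (p.1.card : ℝ) + p.2.card ≤ (1 + ε) * m + β) ∧
      CoversPairs C (κ x.1) (κ x.2) m := by
    intro x hx
    obtain ⟨-, hx1, hx2⟩ := Finset.mem_filter.1 hx
    refine exists_containers_of_card_le hε hε1 hβ0 hβ hq hqm hr k _ (fewOutside_subset _ _ _ _) _
      (fewOutside_subset _ _ _ _) hx1 hx2 ?_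
    have h1 : ((κ x.1).card : ℝ) * (κ x.2).card ≤ (5 / 4 * m) * (5 / 4 * m) := by
      refine mul_le_mul ?_ ?_ (by positivity) (by positivity)
      · nlinarith
      · nlinarith
    have h2 : (0 : ℝ) ≤ (1 - ε ^ 3 / 2048) ^ k := pow_nonneg (by linarith) _
    have h3 := mul_le_mul_of_nonneg_left h1 h2
    have h4 := mul_lt_mul_of_pos_right hk (by positivity : 0 < m ^ 2)
    nlinarith
  choose! Φ hΦ using hchild
  -- The initial step, from Y down to size (1 + ε/4)m. Any q elements F of B serve: all but an ε/8
  -- proportion of F + a lies in F + F' for each kept a, so at most m / (1 - ε/8) elements are kept.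
  -- It is applied to A and to B, which accounts for the 2 in the exponent k + 2.
  have hinit : ∀ A ⊆ Y, ∀ B ⊆ Y, q ≤ B.card → ((A + B).card : ℝ) ≤ m →
      ∃ p ∈ P, ((κ p).card : ℝ) ≤ (1 + ε / 4) * m ∧ A ⊆ κ p := by
    intro A hA B hB hqB hAB
    obtain ⟨F, hFB, hFq⟩ := Finset.exists_subset_card_eq hqB
    obtain ⟨F', hF'A, hF'm, hD, hAF⟩ := exists_fingerprint (c := ε / 8 * q) (m := m) (V := Y)
      (by positivity) hFB hA (by rwa [add_comm])
    have hqr : (0 : ℝ) ≤ q * r := by positivity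
    have hεε : ε ^ 3 / 2048 ≤ ε / 8 := by
      have : ε ^ 3 ≤ ε := by
        calc ε ^ 3 ≤ ε ^ 1 := pow_le_pow_of_le_one hε.le hε1 (by norm_num)
          _ = ε := pow_one ε
      linarith
    have hF'r : F'.card ≤ r := by
      have : ε / 8 * q * F'.card ≤ ε / 8 * q * r := hF'm.trans (hr.trans (by nlinarith))
      exact_mod_cast le_of_mul_le_mul_left this (by positivity)
    refine ⟨(F, F'), Finset.mem_product.2 ⟨mem_smallSubsets.2 ⟨hFB.trans hB, hFq.le⟩,
      mem_smallSubsets.2 ⟨hF'A.trans hA, hF'r⟩⟩, ?_, hAF⟩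
    have h1 := card_fewOutside_mul_le (ε / 8 * q) F Y (F + F')
    have hq0 : (0 : ℝ) < q := by linarith
    rw [hFq] at h1
    have h2 : ((F + F').card : ℝ) * q ≤ m * q := mul_le_mul_of_nonneg_right hD hq0.le
    have h3 : q * (((κ (F, F')).card : ℝ) * (1 - ε / 8)) ≤ q * m := by
      have : q * (((κ (F, F')).card : ℝ) * (1 - ε / 8)) = (κ (F, F')).card * (q - ε / 8 * q) := by
        ring
      rw [this]
      linarith
    have h4 := le_of_mul_le_mul_left h3 hq0
    have h5 : ((κ (F, F')).card : ℝ) * (1 - ε / 8) ≤ ((1 + ε / 4) * m) * (1 - ε / 8) := by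
      have : 0 ≤ (ε / 8 - ε ^ 2 / 32) * m := mul_nonneg (by nlinarith) hm.le
      nlinarith
    exact le_of_mul_le_mul_right h5 (by linarith)
  refine ⟨S.biUnion Φ, ?_, ?_, ?_⟩
  · have hS : S.card ≤ (2 * (Y.card + 1) ^ (q + r)) ^ 2 := by
      refine (Finset.card_filter_le _ _).trans ?_
      rw [Finset.card_product, pow_two]
      exact Nat.mul_le_mul (by omega) (by omega)
    rw [add_comm k, pow_add]
    refine (Finset.card_biUnion_le_card_mul _ _ _ fun p hp => (hΦ p hp).1).trans ?_
    exact Nat.mul_le_mul_right _ hS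
  · intro p hp
    obtain ⟨x, hx, hpx⟩ := Finset.mem_biUnion.1 hp
    exact (hΦ x hx).2.1 p hpx
  · intro A hA B hB hAs hBs hAB
    obtain ⟨p, hp, hp1, hp2⟩ := hinit A hA B hB (by omega) hAB
    obtain ⟨p', hp', hp1', hp2'⟩ := hinit B hB A hA (by omega) (by rwa [add_comm])
    have hS : (p, p') ∈ S := Finset.mem_filter.2 ⟨Finset.mem_product.2 ⟨hp, hp'⟩, hp1, hp1'⟩
    obtain ⟨x, hx, h⟩ := (hΦ _ hS).2.2 A hp2 B hp2' hAB
    exact ⟨x, Finset.mem_biUnion.2 ⟨_, hS, hx⟩, h⟩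

end Iterate

/-! ### Estimates for binomial coefficients with real upper entry -/

section Binomial

lemma realChoose_nonneg (x : ℝ) (k : ℕ) : 0 ≤ realChoose x k := by
  rw [realChoose]
  split_ifs with h
  · refine div_nonneg (Finset.prod_nonneg fun i hi => ?_) (by positivity)
    have : (i : ℝ) ≤ k := by exact_mod_cast (Finset.mem_range.1 hi).le
    linarith
  · exact le_rfl

lemma realChoose_mono {x y : ℝ} (h : x ≤ y) (k : ℕ) : realChoose x k ≤ realChoose y k := by
  by_cases hx : (k : ℝ) ≤ x
  · rw [realChoose, realChoose, if_pos hx, if_pos (hx.trans h)]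
    refine div_le_div_of_nonneg_right (Finset.prod_le_prod (fun i hi => ?_) fun i _ => ?_)
      (by positivity)
    · have : (i : ℝ) ≤ k := by exact_mod_cast (Finset.mem_range.1 hi).le
      linarith
    · linarith
  · rw [realChoose, if_neg hx]
    exact realChoose_nonneg _ _

lemma realChoose_natCast (n k : ℕ) : realChoose n k = n.choose k := by
  rw [realChoose]
  split_ifs with h
  · have h' : k ≤ n := by exact_mod_cast h
    rw [Nat.choose_eq_descFactorial_div_factorial, Nat.cast_div (Nat.factorial_dvd_descFactorial _ _)
      (by positivity), Nat.descFactorial_eq_prod_range]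
    push_cast
    congr 1
    refine Finset.prod_congr rfl fun i hi => ?_
    rw [Nat.cast_sub ((Finset.mem_range.1 hi).le.trans h')]
  · have h' : n < k := by
      push Not at h
      exact_mod_cast h
    simp [Nat.choose_eq_zero_of_lt h']

lemma one_le_realChoose {x : ℝ} {k : ℕ} (h : (k : ℝ) ≤ x) : 1 ≤ realChoose x k := by
  calc (1 : ℝ) = realChoose k k := by rw [realChoose_natCast]; simp
    _ ≤ _ := realChoose_mono h k

lemma sum_inv_sqrt_le (k : ℕ) : ∑ j ∈ Finset.range k, 1 / √((j : ℝ) + 1) ≤ 2 * √k := by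
  induction k with
  | zero => simp
  | succ k ih =>
    rw [Finset.sum_range_succ]
    have h0 : (0 : ℝ) ≤ k := by positivity
    have h1 : √(k : ℝ) ^ 2 = k := Real.sq_sqrt h0
    have h2 : √((k : ℝ) + 1) ^ 2 = k + 1 := Real.sq_sqrt (by positivity)
    have h3 : 0 < √((k : ℝ) + 1) := Real.sqrt_pos.2 (by positivity)
    have h4 : 1 / √((k : ℝ) + 1) ≤ 2 * √((k : ℝ) + 1) - 2 * √k := by
      rw [div_le_iff₀ h3]
      nlinarith [sq_nonneg (√((k : ℝ) + 1) - √k)]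
    push_cast
    linarith

/-- With w² = εk/(k - i) the exponents 2w sum to O(√ε k). The bound exp(w²) would give a harmonic
sum and an extra factor log k. -/
lemma one_add_sq_le_exp {w : ℝ} (hw : 0 ≤ w) : 1 + w ^ 2 ≤ Real.exp (2 * w) := by
  have := Real.quadratic_le_exp_of_nonneg (x := 2 * w) (by positivity)
  nlinarith [sq_nonneg w]

/-- Increasing `x` by a factor `1 + ε` changes the binomial coefficient only slightly. -/
lemma realChoose_mul_le {x ε : ℝ} {k : ℕ} (hε : 0 ≤ ε) (hx : (k : ℝ) ≤ x) :
    realChoose ((1 + ε) * x) k ≤ Real.exp (4 * √ε * k) * realChoose x k := by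
  have hx0 : 0 ≤ x := le_trans (by positivity) hx
  have hx' : (k : ℝ) ≤ (1 + ε) * x := by nlinarith
  rw [realChoose, realChoose, if_pos hx, if_pos hx', ← mul_div_assoc]
  refine div_le_div_of_nonneg_right ?_ (by positivity)
  have hfac : ∀ i ∈ Finset.range k, (1 + ε) * x - i ≤
      Real.exp (2 * (√ε * √k * (1 / √(((k - 1 - i : ℕ) : ℝ) + 1)))) * (x - i) := by
    intro i hi
    have hik := Finset.mem_range.1 hi
    have hcast : ((k - 1 - i : ℕ) : ℝ) + 1 = k - i := by
      have : (k - 1 - i) + 1 + i = k := by omega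
      have : (((k - 1 - i : ℕ) : ℝ) + 1) + i = k := by exact_mod_cast this
      linarith
    have hpos : (0 : ℝ) < k - i := by
      have : (i : ℝ) < k := by exact_mod_cast hik
      linarith
    have h1 := one_add_sq_le_exp (w := √ε * √k * (1 / √(((k - 1 - i : ℕ) : ℝ) + 1)))
      (by positivity)
    refine le_trans ?_ (mul_le_mul_of_nonneg_right h1 (by linarith))
    rw [mul_pow, mul_pow, div_pow, hcast, Real.sq_sqrt hε, Real.sq_sqrt (by positivity),
      Real.sq_sqrt hpos.le, one_pow]
    have h2 : x ≤ k / (k - i) * (x - i) := by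
      rw [div_mul_eq_mul_div, le_div_iff₀ hpos]
      have : (0 : ℝ) ≤ i := by positivity
      nlinarith
    have h3 := mul_le_mul_of_nonneg_left h2 hε
    have h4 : (1 + ε * k * (1 / (k - i))) * (x - i) = x - i + ε * (k / (k - i) * (x - i)) := by
      ring
    rw [h4]
    linarith
  refine (Finset.prod_le_prod (fun i hi => ?_) hfac).trans ?_
  · have : (i : ℝ) ≤ k := by exact_mod_cast (Finset.mem_range.1 hi).le
    linarith
  rw [Finset.prod_mul_distrib, ← Real.exp_sum]
  refine mul_le_mul_of_nonneg_right (Real.exp_le_exp.2 ?_) (Finset.prod_nonneg fun i hi => ?_)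
  · rw [← Finset.mul_sum, ← Finset.mul_sum,
      Finset.sum_range_reflect (fun j => 1 / √((j : ℝ) + 1)) k]
    have h1 := mul_le_mul_of_nonneg_left (sum_inv_sqrt_le k) (by positivity : 0 ≤ √ε * √k)
    have h2 : √(k : ℝ) * √k = k := Real.mul_self_sqrt (by positivity)
    calc 2 * (√ε * √k * ∑ j ∈ Finset.range k, 1 / √((j : ℝ) + 1))
        ≤ 2 * (√ε * √k * (2 * √k)) := by linarith
      _ = 4 * √ε * (√(k : ℝ) * √k) := by ring
      _ = _ := by rw [h2]
  · have : (i : ℝ) ≤ k := by exact_mod_cast (Finset.mem_range.1 hi).le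
    linarith

lemma choose_mul_pow_le {l : ℝ} (hl : 0 ≤ l) (a s : ℕ) :
    (a.choose s : ℝ) * l ^ s ≤ (1 + l) ^ a := by
  rw [add_comm, add_pow]
  obtain h | h := Nat.lt_or_ge a s
  · rw [Nat.choose_eq_zero_of_lt h]
    simp only [Nat.cast_zero, zero_mul]
    positivity
  · refine le_trans (le_of_eq ?_) (Finset.single_le_sum
      (f := fun i => l ^ i * 1 ^ (a - i) * (a.choose i : ℝ)) (fun i _ => by positivity)
      (Finset.mem_range.2 (Nat.lt_succ_of_le h)))
    simp [mul_comm]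

/-- The terms of the binomial expansion of `(1 + l) ^ N` are largest at `s` if
`l = s / (x - s)` and `N = ⌊x⌋`. -/
lemma choose_mul_pow_le_mode {x l : ℝ} {s : ℕ} (hx : (s : ℝ) < x) (hl : l * (x - s) = s) (k : ℕ) :
    (⌊x⌋₊.choose k : ℝ) * l ^ k ≤ ⌊x⌋₊.choose s * l ^ s := by
  have hl0 : 0 ≤ l := by
    by_contra h
    push Not at h
    have : (0 : ℝ) ≤ s := by positivity
    nlinarith
  have hx0 : 0 ≤ x := le_trans (by positivity) hx.le
  set N := ⌊x⌋₊ with hN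
  have hNx : (N : ℝ) ≤ x := Nat.floor_le hx0
  have hxN : x < N + 1 := Nat.lt_floor_add_one x
  have hsN : s ≤ N := Nat.le_floor hx.le
  have hstep : ∀ j, j < N →
      (N.choose (j + 1) : ℝ) * l ^ (j + 1) * (j + 1) = N.choose j * l ^ j * (l * (N - j)) := by
    intro j hj
    have h := Nat.choose_succ_right_eq N j
    have h' : (N.choose (j + 1) : ℝ) * (j + 1) = N.choose j * (N - j) := by
      rw [← Nat.cast_sub hj.le]
      exact_mod_cast h
    rw [pow_succ]
    linear_combination l ^ j * l * h'
  have hup : ∀ j, s ≤ j → (N.choose (j + 1) : ℝ) * l ^ (j + 1) ≤ N.choose j * l ^ j := by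
    intro j hj
    obtain h | h := Nat.lt_or_ge j N
    · have hj1 : (0 : ℝ) < j + 1 := by positivity
      refine le_of_mul_le_mul_right ?_ hj1
      rw [hstep j h]
      refine mul_le_mul_of_nonneg_left ?_ (by positivity)
      have : (s : ℝ) ≤ j := by exact_mod_cast hj
      have : l * (N - j) ≤ l * (x - s) := mul_le_mul_of_nonneg_left (by linarith) hl0
      linarith
    · rw [Nat.choose_eq_zero_of_lt (by omega : N < j + 1)]
      simp only [Nat.cast_zero, zero_mul]
      positivity
  have hdown : ∀ j, j < s → (N.choose j : ℝ) * l ^ j ≤ N.choose (j + 1) * l ^ (j + 1) := by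
    intro j hj
    have hj1 : (0 : ℝ) < j + 1 := by positivity
    refine le_of_mul_le_mul_right ?_ hj1
    rw [hstep j (by omega)]
    refine mul_le_mul_of_nonneg_left ?_ (by positivity)
    have : (j : ℝ) + 1 ≤ s := by exact_mod_cast hj
    have : l * (x - s) ≤ l * (N - j) := mul_le_mul_of_nonneg_left (by linarith) hl0
    linarith
  obtain h | h := le_total s k
  · exact antitoneOn_nat_Ici_of_succ_le (f := fun j => (N.choose j : ℝ) * l ^ j) hup
      (Set.mem_Ici.2 le_rfl) (Set.mem_Ici.2 h) h
  · have key : ∀ d k, k + d = s → (N.choose k : ℝ) * l ^ k ≤ N.choose s * l ^ s := by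
      intro d
      induction d with
      | zero =>
        rintro k rfl
        exact le_rfl
      | succ d ih =>
        intro k hk
        exact (hdown k (by omega)).trans (ih (k + 1) (by omega))
    exact key (s - k) k (by omega)

lemma pow_le_choose_mul_pow {x l : ℝ} {s : ℕ} (hx : (s : ℝ) < x) (hl : l * (x - s) = s) :
    (1 + l) ^ ⌊x⌋₊ ≤ (⌊x⌋₊ + 1) * (⌊x⌋₊.choose s * l ^ s) := by
  rw [add_comm, add_pow]
  refine (Finset.sum_le_card_nsmul _ _ (⌊x⌋₊.choose s * l ^ s) fun k _ => ?_).trans ?_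
  · refine le_trans (le_of_eq ?_) (choose_mul_pow_le_mode hx hl k)
    simp [mul_comm]
  · simp

/-- A product of binomial coefficients with a given sum of the upper entries is essentially
largest if these are proportional to the lower entries. -/
lemma choose_mul_choose_le {x y l : ℝ} {a b s s' : ℕ} (hl : 0 < l) (hx : (s : ℝ) < x)
    (hy : (s' : ℝ) < y) (hlx : l * (x - s) = s) (hly : l * (y - s') = s')
    (hab : (a : ℝ) + b ≤ x + y) :
    (a.choose s : ℝ) * b.choose s' ≤
      (1 + l) * ((x + 1) * (y + 1)) * (realChoose x s * realChoose y s') := by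
  have hx0 : 0 ≤ x := le_trans (by positivity) hx.le
  have hy0 : 0 ≤ y := le_trans (by positivity) hy.le
  -- Rounding x and y down can lose one unit in total, which is paid for by the factor 1 + l.
  have hN : a + b ≤ ⌊x⌋₊ + ⌊y⌋₊ + 1 := by
    have h1 := Nat.lt_floor_add_one x
    have h2 := Nat.lt_floor_add_one y
    have : ((a + b : ℕ) : ℝ) < (⌊x⌋₊ + ⌊y⌋₊ + 1 + 1 : ℕ) := by
      push_cast
      linarith
    have : a + b < ⌊x⌋₊ + ⌊y⌋₊ + 1 + 1 := by exact_mod_cast this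
    omega
  have h1 := mul_le_mul (choose_mul_pow_le hl.le a s) (choose_mul_pow_le hl.le b s')
    (by positivity) (by positivity)
  have h2 := mul_le_mul (pow_le_choose_mul_pow hx hlx) (pow_le_choose_mul_pow hy hly)
    (by positivity) (by positivity)
  have h3 : (1 + l) ^ a * (1 + l) ^ b ≤ (1 + l) * ((1 + l) ^ ⌊x⌋₊ * (1 + l) ^ ⌊y⌋₊) := by
    rw [← pow_add, ← pow_add, ← pow_succ']
    exact pow_le_pow_right₀ (by linarith) hN
  have h4 : (a.choose s : ℝ) * b.choose s' * (l ^ s * l ^ s') ≤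
      (1 + l) * ((⌊x⌋₊ + 1) * (⌊y⌋₊ + 1)) * (⌊x⌋₊.choose s * ⌊y⌋₊.choose s') *
        (l ^ s * l ^ s') := by
    have h5 := mul_le_mul_of_nonneg_left h2 (by linarith : 0 ≤ 1 + l)
    calc _ = (a.choose s : ℝ) * l ^ s * (b.choose s' * l ^ s') := by ring
      _ ≤ _ := h1.trans (h3.trans h5)
      _ = _ := by ring
  have h6 := le_of_mul_le_mul_right h4 (by positivity)
  refine h6.trans ?_
  have hfx := Nat.floor_le hx0
  have hfy := Nat.floor_le hy0
  rw [← realChoose_natCast, ← realChoose_natCast]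
  have := realChoose_nonneg ⌊x⌋₊ s
  have := realChoose_nonneg ⌊y⌋₊ s'
  have := realChoose_nonneg x s
  have h7 := realChoose_mono hfx s
  have h8 := realChoose_mono hfy s'
  gcongr

end Binomial

/-! ### Counting pairs through containers -/

section Counting

lemma card_smallSumsetPairs_le_sum {G : Type*} [AddCommGroup G] [DecidableEq G] {Y : Finset G}
    {m s s' : ℕ} (C : Finset (Finset G × Finset G))
    (hC : ∀ A ⊆ Y, ∀ B ⊆ Y, A.card = s → B.card = s' → ((A + B).card : ℝ) ≤ m →
        ∃ p ∈ C, A ⊆ p.1 ∧ B ⊆ p.2) :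
    (smallSumsetPairs Y m s s').card ≤ ∑ p ∈ C, p.1.card.choose s * p.2.card.choose s' := by
  have hsub : smallSumsetPairs Y m s s' ⊆
      C.biUnion fun p => p.1.powersetCard s ×ˢ p.2.powersetCard s' := by
    rintro ⟨A, B⟩ hAB
    rw [smallSumsetPairs, Finset.mem_filter, Finset.mem_product, Finset.mem_powersetCard,
      Finset.mem_powersetCard] at hAB
    obtain ⟨⟨⟨hA, hAs⟩, hB, hBs⟩, hm⟩ := hAB
    obtain ⟨p, hp, hpA, hpB⟩ := hC A hA B hB hAs hBs (by exact_mod_cast hm)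
    exact Finset.mem_biUnion.2 ⟨p, hp, Finset.mem_product.2
      ⟨Finset.mem_powersetCard.2 ⟨hpA, hAs⟩, Finset.mem_powersetCard.2 ⟨hpB, hBs⟩⟩⟩
  refine (Finset.card_le_card hsub).trans (Finset.card_biUnion_le.trans (le_of_eq ?_))
  refine Finset.sum_congr rfl fun p _ => ?_
  rw [Finset.card_product, Finset.card_powersetCard, Finset.card_powersetCard]

lemma choose_mul_choose_le_realChoose {ε β : ℝ} {m a b s s' : ℕ} (hε : 0 < ε) (hε1 : ε ≤ 1)
    (hβ0 : 0 ≤ β) (hβ2 : β ≤ 2 * m) (hs : 1 ≤ s) (hs' : 1 ≤ s') (hm : s + s' ≤ m)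
    (hab : (a : ℝ) + b ≤ (1 + ε) * m + β) :
    (a.choose s : ℝ) * b.choose s' ≤ (1 + 1 / ε) * (49 * (m : ℝ) ^ 2) *
      Real.exp (4 * √ε * (s + s')) * (realChoose ((m + β) * s / (s + s')) s *
        realChoose ((m + β) * s' / (s + s')) s') := by
  have hs0 : (1 : ℝ) ≤ s := by exact_mod_cast hs
  have hs0' : (1 : ℝ) ≤ s' := by exact_mod_cast hs'
  have hmR : (s : ℝ) + s' ≤ m := by exact_mod_cast hm
  have hσ : (0 : ℝ) < s + s' := by linarith
  set X : ℝ := m + β with hX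
  have hXσ : 1 ≤ X / (s + s') := by rw [le_div_iff₀ hσ]; linarith
  -- The proportional entries are ρs and ρs'. The factor 1 + ε keeps ρ - 1 ≥ ε, so the weight 1/(ρ -
  -- 1) stays bounded even when m + β = s + s'.
  set ρ : ℝ := (1 + ε) * (X / (s + s')) with hρ
  have hρ1 : ε ≤ ρ - 1 := by nlinarith
  have hρ0 : 0 < ρ - 1 := by linarith
  have hsum : ρ * s + ρ * s' = (1 + ε) * X := by rw [hρ]; field_simp
  have hbound : (1 + ε) * X ≤ 6 * m := by nlinarith
  have hl : 1 / (ρ - 1) ≤ 1 / ε := one_div_le_one_div_of_le hε hρ1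
  have h1 := choose_mul_choose_le (x := ρ * s) (y := ρ * s') (l := 1 / (ρ - 1)) (a := a) (b := b)
    (s := s) (s' := s') (by positivity) (by nlinarith) (by nlinarith) (by field_simp)
    (by field_simp) (by rw [hsum]; nlinarith)
  have hx : (s : ℝ) ≤ X * s / (s + s') := by
    rw [mul_div_right_comm]; nlinarith
  have hy : (s' : ℝ) ≤ X * s' / (s + s') := by
    rw [mul_div_right_comm]; nlinarith
  have h2 := realChoose_mul_le hε.le hx
  have h3 := realChoose_mul_le hε.le hy
  have e1 : (1 + ε) * (X * s / (s + s')) = ρ * s := by rw [hρ]; ring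
  have e2 : (1 + ε) * (X * s' / (s + s')) = ρ * s' := by rw [hρ]; ring
  rw [e1] at h2
  rw [e2] at h3
  have h4 := mul_le_mul h2 h3 (realChoose_nonneg _ _)
    (mul_nonneg (Real.exp_pos _).le (realChoose_nonneg _ _))
  have h5 : (ρ * s + 1) * (ρ * s' + 1) ≤ 49 * (m : ℝ) ^ 2 := by
    have hρs : 0 ≤ ρ * s := by positivity
    have hρs' : 0 ≤ ρ * s' := by positivity
    calc (ρ * s + 1) * (ρ * s' + 1) ≤ (7 * m) * (7 * m) :=
          mul_le_mul (by linarith) (by linarith) (by positivity) (by positivity)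
      _ = _ := by ring
  have h6 : (1 + 1 / (ρ - 1)) * ((ρ * s + 1) * (ρ * s' + 1)) ≤
      (1 + 1 / ε) * (49 * (m : ℝ) ^ 2) :=
    mul_le_mul (by linarith) h5 (by positivity) (by positivity)
  refine h1.trans ((mul_le_mul h6 h4 (mul_nonneg (realChoose_nonneg _ _) (realChoose_nonneg _ _))
    (by positivity)).trans (le_of_eq ?_))
  rw [mul_add (4 * √ε), Real.exp_add]
  ring

/-- An upper bound for the number of pairs of sets with a small sumset, with explicit error
terms. -/
theorem card_smallSumsetPairs_le {G : Type*} [AddCommGroup G] [DecidableEq G]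
    {ε β : ℝ} {m q k s s' : ℕ} {Y : Finset G}
    (hε : 0 < ε) (hε1 : ε ≤ 1) (hβ0 : 0 ≤ β) (hβ2 : β ≤ 2 * m)
    (hβ : ∀ H : AddSubgroup G, (H : Set G).Finite → ((H : Set G).ncard : ℝ) ≤ (1 + ε) * m →
      ((H : Set G).ncard : ℝ) ≤ β)
    (hq : 1024 ≤ ε ^ 3 * q) (hqm : q ≤ ε ^ 3 / 512 * m) (hr : m ≤ ε ^ 3 / 2048 * q * q)
    (hk : 25 * (1 - ε ^ 3 / 2048) ^ k < 9 * ε ^ 2) (hqs : q ≤ s) (hqs' : q ≤ s')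
    (hs : 1 ≤ s) (hs' : 1 ≤ s') (hm : s + s' ≤ m) :
    ((smallSumsetPairs Y m s s').card : ℝ) ≤ (2 * ((Y.card : ℝ) + 1) ^ (q + q)) ^ (k + 2) *
      ((1 + 1 / ε) * (49 * (m : ℝ) ^ 2) * Real.exp (4 * √ε * (s + s')) *
        (realChoose ((m + β) * s / (s + s')) s * realChoose ((m + β) * s' / (s + s')) s')) := by
  obtain ⟨C, hC, hCp, hCc⟩ := exists_containers (Y := Y) hε hε1 hβ0 hβ hq hqm hr hk hqs hqs'
  have h1 : ((smallSumsetPairs Y m s s').card : ℝ) ≤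
      ∑ p ∈ C, (p.1.card.choose s : ℝ) * p.2.card.choose s' := by
    exact_mod_cast card_smallSumsetPairs_le_sum C hCc
  refine h1.trans ((Finset.sum_le_card_nsmul _ _ _ fun p hp =>
    choose_mul_choose_le_realChoose hε hε1 hβ0 hβ2 hs hs' hm (hCp p hp)).trans ?_)
  rw [nsmul_eq_mul]
  refine mul_le_mul_of_nonneg_right (by exact_mod_cast hC) ?_
  have := realChoose_nonneg ((m + β) * s / (s + s')) s
  have := realChoose_nonneg ((m + β) * s' / (s + s')) s'
  positivity

/-! ### Choice of parameters and passage to the limit -/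

lemma ncard_le_maxSubgroupSize {G : Type*} [AddCommGroup G] {x : ℝ} (hx : 1 ≤ x)
    (H : AddSubgroup G) (hH : (H : Set G).Finite) (h : ((H : Set G).ncard : ℝ) ≤ x) :
    (H : Set G).ncard ≤ maxSubgroupSize G x :=
  (maxSubgroupSize_isGreatest G hx).2 ⟨H, hH, rfl, h⟩

lemma maxSubgroupSize_le {G : Type*} [AddCommGroup G] {x : ℝ} (hx : 1 ≤ x) :
    (maxSubgroupSize G x : ℝ) ≤ x := by
  obtain ⟨H, -, -, h⟩ := (maxSubgroupSize_isGreatest G hx).1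
  exact h

lemma exp_le_two_rpow {z : ℝ} (hz : 0 ≤ z) : Real.exp z ≤ (2 : ℝ) ^ (2 * z) := by
  rw [Real.rpow_def_of_pos two_pos]
  refine Real.exp_le_exp.2 ?_
  have := Real.log_two_gt_d9
  nlinarith

lemma eventually_mul_pow_le_two_rpow (K : ℝ) {b : ℝ} (hb : 0 < b) :
    ∀ᶠ x : ℝ in atTop, K * x ^ 4 ≤ (2 : ℝ) ^ (b * x) := by
  have hlog : 0 < Real.log 2 * b := mul_pos (Real.log_pos one_lt_two) hb
  have h := (isLittleO_pow_exp_pos_mul_atTop 4 hlog).bound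
    (by positivity : (0 : ℝ) < 1 / (|K| + 1))
  filter_upwards [h] with x hx
  rw [Real.norm_of_nonneg (by positivity), Real.norm_of_nonneg (by positivity),
    div_mul_eq_mul_div, le_div_iff₀ (by positivity), one_mul] at hx
  rw [Real.rpow_def_of_pos two_pos, ← mul_assoc]
  refine le_trans ?_ hx
  have : (0 : ℝ) ≤ x ^ 4 := by positivity
  nlinarith [le_abs_self K]

lemma two_mul_pow_le_two_rpow {n q k : ℕ} {b L : ℝ} (hn : 2 ≤ n) (hL : L = Real.logb 2 n)
    (hb : L * q ≤ b) (hb1 : L ≤ b) :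
    (2 * ((n : ℝ) + 1) ^ (q + q)) ^ (k + 2) ≤ (2 : ℝ) ^ (6 * ((k : ℝ) + 2) * b) := by
  have hn' : (2 : ℝ) ≤ n := by exact_mod_cast hn
  have h2 : (2 : ℝ) ^ L = n := by
    rw [hL]; exact Real.rpow_logb two_pos (by norm_num) (by linarith)
  have hn1 : (n : ℝ) + 1 ≤ (2 : ℝ) ^ (2 * L) := by
    rw [two_mul, Real.rpow_add two_pos, h2]
    nlinarith
  have h1 : 2 * ((n : ℝ) + 1) ^ (q + q) ≤ ((n : ℝ) + 1) ^ (q + q + 1) := by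
    rw [pow_succ']
    exact mul_le_mul_of_nonneg_right (by linarith) (by positivity)
  calc (2 * ((n : ℝ) + 1) ^ (q + q)) ^ (k + 2)
      ≤ (((n : ℝ) + 1) ^ (q + q + 1)) ^ (k + 2) := pow_le_pow_left₀ (by positivity) h1 _
    _ ≤ (((2 : ℝ) ^ (2 * L)) ^ (q + q + 1)) ^ (k + 2) := by gcongr
    _ = (2 : ℝ) ^ (2 * L * ((q + q + 1 : ℕ) : ℝ) * ((k + 2 : ℕ) : ℝ)) := by
        rw [Real.rpow_mul_natCast two_pos.le, Real.rpow_mul_natCast two_pos.le]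
    _ ≤ _ := by
        refine Real.rpow_le_rpow_of_exponent_le one_le_two ?_
        push_cast
        have h3 : 2 * L * ((q : ℝ) + q + 1) ≤ 6 * b := by linarith
        have := mul_le_mul_of_nonneg_right h3 (by positivity : (0 : ℝ) ≤ (k : ℝ) + 2)
        linarith

/-- A statement that holds eventually for every fixed `ε > 0` also holds eventually for some
sequence `ε → 0`. -/
lemma exists_tendsto_zero_of_eventually {P : ℕ → ℝ → Prop}
    (h : ∀ ε : ℝ, 0 < ε → ε ≤ 1 → ∀ᶠ n in atTop, P n ε) :
    ∃ e : ℕ → ℝ, Tendsto e atTop (nhds 0) ∧ (∀ n, 0 ≤ e n) ∧ ∀ᶠ n in atTop, P n (e n) := by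
  have h' : ∀ k : ℕ, ∃ N, ∀ n ≥ N, P n (1 / ((k : ℝ) + 1)) := fun k =>
    eventually_atTop.1 (h _ (by positivity) (by
      rw [div_le_one (by positivity)]
      have : (0 : ℝ) ≤ k := by positivity
      linarith))
  choose N hN using h'
  -- Diagonalization: `K n` is the largest k ≤ n whose threshold has been passed by time n.
  let K : ℕ → ℕ := fun n => Nat.findGreatest (fun k => N k ≤ n) n
  have hK : Tendsto K atTop atTop := by
    refine tendsto_atTop.2 fun k => ?_
    filter_upwards [eventually_ge_atTop (max k (N k))] with n hn
    exact Nat.le_findGreatest (le_of_max_le_left hn) (le_of_max_le_right hn)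
  refine ⟨fun n => 1 / ((K n : ℝ) + 1), tendsto_one_div_add_atTop_nhds_zero_nat.comp hK,
    fun n => by positivity, ?_⟩
  filter_upwards [eventually_ge_atTop (N 0)] with n hn
  exact hN _ n (Nat.findGreatest_spec (P := fun k => N k ≤ n) (Nat.zero_le n) hn)

universe u

/-- The bound of the counting theorem with error terms `η s` and `η m`. -/
lemma eventually_card_smallSumsetPairs_le (m s s' : ℕ → ℕ)
    (hpos : ∀ n : ℕ, 1 ≤ n → 1 ≤ m n ∧ 1 ≤ s n ∧ 1 ≤ s' n)
    (hss' : (fun n : ℕ => (s' n : ℝ)) =Θ[atTop] (fun n : ℕ => (s n : ℝ)))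
    (hm_lower : ∀ n : ℕ, 1 ≤ n → s n + s' n ≤ m n)
    (hm_upper : (fun n : ℕ => (m n : ℝ)) =o[atTop]
      (fun n : ℕ => (s n : ℝ) ^ 2 / (Real.logb 2 (n : ℝ)) ^ 2))
    {η : ℝ} (hη : 0 < η) (hη1 : η ≤ 1) :
    ∀ᶠ n in atTop, ∀ (G : Type u) [AddCommGroup G] [DecidableEq G] (Y : Finset G), Y.card = n →
      ((smallSumsetPairs Y (m n) (s n) (s' n)).card : ℝ) ≤
        (2 : ℝ) ^ (η * s n) *
          realChoose (((m n : ℝ) + (maxSubgroupSize G ((m n : ℝ) + η * m n) : ℝ)) * (s n : ℝ) /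
            ((s n : ℝ) + (s' n : ℝ))) (s n) *
          realChoose (((m n : ℝ) + (maxSubgroupSize G ((m n : ℝ) + η * m n) : ℝ)) * (s' n : ℝ) /
            ((s n : ℝ) + (s' n : ℝ))) (s' n) := by
  obtain ⟨c, hc, hsc⟩ := hss'.1.exists_pos
  obtain ⟨c', hc', hsc'⟩ := hss'.2.exists_pos
  -- The exponent ηs is split as η/4 + η/4 + η/2 for the number of containers, the polynomial factor
  -- and the cost of 1 + ε. Here √ε = a makes 8√ε(s + s') ≤ ηs/2, and θ below makes 6(k + 2)θ = η/4.
  set a : ℝ := η / (16 * (1 + c)) with ha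
  have ha0 : 0 < a := by positivity
  have ha1 : a ≤ η := by
    refine div_le_self hη.le ?_
    linarith
  set ε : ℝ := a ^ 2 with hε
  have hε0 : 0 < ε := by positivity
  have hεη : ε ≤ η := by
    rw [hε, pow_two]
    exact (mul_le_of_le_one_left ha0.le (ha1.trans hη1)).trans ha1
  have hε1 : ε ≤ 1 := hεη.trans hη1
  have hεsqrt : √ε = a := Real.sqrt_sq ha0.le
  have hε3 : ε ^ 3 ≤ 1 := pow_le_one₀ hε0.le hε1
  have hε3' : 0 < ε ^ 3 := by positivity
  obtain ⟨k, hk⟩ := exists_pow_lt_of_lt_one (by positivity : 0 < 9 * ε ^ 2 / 25)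
    (by linarith : 1 - ε ^ 3 / 2048 < 1)
  set θ : ℝ := η / (24 * ((k : ℝ) + 2)) with hθ
  have hθ0 : 0 < θ := by positivity
  have hθ1 : θ ≤ 1 := by
    rw [hθ, div_le_one (by positivity)]
    have : (0 : ℝ) ≤ k := by positivity
    linarith
  set κ : ℝ := ε ^ 3 / 2048 * (θ / 2) ^ 2 with hκ
  have hκ0 : 0 < κ := by positivity
  have hκ1 : κ ≤ 1 := by
    have : (θ / 2) ^ 2 ≤ 1 := pow_le_one₀ (by positivity) (by linarith)
    exact mul_le_one₀ (by linarith) (by positivity) this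
  obtain ⟨T, hT⟩ := eventually_atTop.1
    (eventually_mul_pow_le_two_rpow ((1 + 1 / ε) * 49) (by positivity : 0 < η / 4))
  have hlog : Tendsto (fun n : ℕ => Real.logb 2 (n : ℝ)) atTop atTop :=
    (Real.tendsto_logb_atTop one_lt_two).comp tendsto_natCast_atTop_atTop
  filter_upwards [hsc.bound, hsc'.bound, hm_upper.bound hκ0, eventually_ge_atTop 2,
    hlog.eventually_ge_atTop 1, hlog.eventually_ge_atTop T, hlog.eventually_ge_atTop (512 / ε ^ 3),
    hlog.eventually_ge_atTop c', hlog.eventually_ge_atTop (2048 / (ε ^ 3 * θ))]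
    with n h1 h2 h3 hn hL1 hLT hLε hLc hLq
  intro G _ _ Y hY
  obtain ⟨hm1, hs1, hs1'⟩ := hpos n (by omega)
  have hmn := hm_lower n (by omega)
  generalize m n = m at *
  generalize s n = s at *
  generalize s' n = s' at *
  set L := Real.logb 2 (n : ℝ) with hL
  have hL0 : 0 < L := by linarith
  rw [Real.norm_of_nonneg (by positivity), Real.norm_of_nonneg (by positivity)] at h1 h2 h3
  have hsR : (1 : ℝ) ≤ s := by exact_mod_cast hs1
  have hsR' : (1 : ℝ) ≤ s' := by exact_mod_cast hs1'
  have hmR : (s : ℝ) + s' ≤ m := by exact_mod_cast hmn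
  have hLs : L * L ≤ s := by
    have : (s : ℝ) ≤ s ^ 2 / L ^ 2 := by
      have : κ * ((s : ℝ) ^ 2 / L ^ 2) ≤ 1 * ((s : ℝ) ^ 2 / L ^ 2) :=
        mul_le_mul_of_nonneg_right hκ1 (by positivity)
      linarith
    rw [le_div_iff₀ (by positivity), pow_two (s : ℝ), pow_two L] at this
    exact le_of_mul_le_mul_left this (by linarith)
  have hLs' : L ≤ s / L := by rwa [le_div_iff₀ hL0]
  have hms : (m : ℝ) ≤ s ^ 2 := by
    have h5 : (s : ℝ) ^ 2 / L ^ 2 ≤ s ^ 2 := div_le_self (by positivity) (one_le_pow₀ hL1)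
    have h6 : κ * ((s : ℝ) ^ 2 / L ^ 2) ≤ 1 * ((s : ℝ) ^ 2 / L ^ 2) :=
        mul_le_mul_of_nonneg_right hκ1 (by positivity)
    linarith
  -- The fingerprint size before rounding, for both q and r. The constant κ is chosen so that m ≤
  -- κs²/L² reads m ≤ (ε³/2048)(w/2)², and w/2 ≤ q.
  set w : ℝ := θ * (s / L) with hw
  have hw0 : 0 ≤ w := by positivity
  have hw1 : 2048 / ε ^ 3 ≤ w := by
    have : 2048 / (ε ^ 3 * θ) ≤ s / L := hLq.trans hLs'
    calc 2048 / ε ^ 3 = θ * (2048 / (ε ^ 3 * θ)) := by field_simp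
      _ ≤ _ := mul_le_mul_of_nonneg_left this hθ0.le
  have hw2 : 2048 ≤ w := by
    refine le_trans ?_ hw1
    rw [le_div_iff₀ hε3']
    linarith
  set q := ⌊w⌋₊ with hq
  have hqw : (q : ℝ) ≤ w := Nat.floor_le hw0
  have hwq : w / 2 ≤ q := by
    have := Nat.lt_floor_add_one w
    rw [← hq] at this
    linarith
  have hqL : L * w = θ * s := by rw [hw]; field_simp
  have hqLs : L * q ≤ s := by
    have h5 : L * q ≤ L * w := mul_le_mul_of_nonneg_left hqw hL0.le
    have h6 : θ * (s : ℝ) ≤ s := mul_le_of_le_one_left (by positivity) hθ1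
    linarith
  have hηm : 0 ≤ η * (m : ℝ) := by positivity
  have hηm1 : η * (m : ℝ) ≤ m := mul_le_of_le_one_left (by positivity) hη1
  have hεm : ε * (m : ℝ) ≤ η * m := mul_le_mul_of_nonneg_right hεη (by positivity)
  have hx1 : 1 ≤ (m : ℝ) + η * m := by linarith
  set β := maxSubgroupSize G ((m : ℝ) + η * m) with hβ
  have hβle : (β : ℝ) ≤ m + η * m := maxSubgroupSize_le hx1
  have hmain := card_smallSumsetPairs_le (Y := Y) (β := β) (q := q) (k := k) (m := m) (s := s)
    (s' := s') hε0 hε1 (by positivity) (by linarith)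
    (fun H hH hHm => by
      exact_mod_cast ncard_le_maxSubgroupSize hx1 H hH (by linarith))
    (by
      rw [div_le_iff₀ hε3'] at hw1
      have := mul_le_mul_of_nonneg_right hwq hε3'.le
      linarith)
    (by
      have h5 : L * q ≤ L * (ε ^ 3 / 512 * m) := by
        rw [div_le_iff₀ hε3'] at hLε
        have : (m : ℝ) * 512 ≤ m * (L * ε ^ 3) := mul_le_mul_of_nonneg_left hLε (by positivity)
        linarith
      exact le_of_mul_le_mul_left h5 hL0)
    (by
      have h5 : w / 2 * (w / 2) ≤ (q : ℝ) * q := mul_self_le_mul_self (by positivity) hwq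
      have h6 : κ * ((s : ℝ) ^ 2 / L ^ 2) = ε ^ 3 / 2048 * (w / 2 * (w / 2)) := by
        rw [hκ, hw]; ring
      rw [h6] at h3
      have := mul_le_mul_of_nonneg_left h5 (by positivity : 0 ≤ ε ^ 3 / 2048)
      linarith)
    (by linarith)
    (by
      have : (q : ℝ) ≤ s := by
        have : 1 * (q : ℝ) ≤ L * q := mul_le_mul_of_nonneg_right hL1 (by positivity)
        linarith
      exact_mod_cast this)
    (by
      have h5 : L * q ≤ L * s' := by
        have : c' * s' ≤ L * (s' : ℝ) := mul_le_mul_of_nonneg_right hLc (by positivity)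
        linarith
      exact_mod_cast le_of_mul_le_mul_left h5 hL0)
    hs1 hs1' hmn
  rw [hY] at hmain
  refine hmain.trans ?_
  have hR : 0 ≤ realChoose ((m + β : ℝ) * s / (s + s')) s *
      realChoose ((m + β : ℝ) * s' / (s + s')) s' :=
    mul_nonneg (realChoose_nonneg _ _) (realChoose_nonneg _ _)
  rw [mul_assoc ((2 : ℝ) ^ (η * s)), ← mul_assoc (_ ^ (k + 2))]
  refine mul_le_mul_of_nonneg_right ?_ hR
  have b1 := two_mul_pow_le_two_rpow (k := k) (q := q) (b := θ * s) hn hL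
    (by rw [← hqL]; exact mul_le_mul_of_nonneg_left hqw hL0.le)
    (by rw [← hqL]; exact le_mul_of_one_le_right hL0.le (by linarith))
  have e1 : 6 * ((k : ℝ) + 2) * (θ * s) = η / 4 * s := by rw [hθ]; field_simp; norm_num
  rw [e1] at b1
  -- Since m ≤ s², the factor is O(s⁴); it is absorbed because s ≥ L² tends to infinity.
  have b2 : (1 + 1 / ε) * (49 * (m : ℝ) ^ 2) ≤ (2 : ℝ) ^ (η / 4 * s) := by
    refine le_trans ?_ (hT s (by
      have : L * 1 ≤ L * L := mul_le_mul_of_nonneg_left hL1 hL0.le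
      linarith))
    have : (m : ℝ) ^ 2 ≤ (s ^ 2) ^ 2 := pow_le_pow_left₀ (by positivity) hms 2
    have h6 : (0 : ℝ) ≤ (1 + 1 / ε) * 49 := by positivity
    have := mul_le_mul_of_nonneg_left this h6
    calc _ = (1 + 1 / ε) * 49 * (m : ℝ) ^ 2 := by ring
      _ ≤ _ := this
      _ = _ := by ring
  have b3 : Real.exp (4 * √ε * (s + s')) ≤ (2 : ℝ) ^ (η / 2 * s) := by
    rw [hεsqrt]
    refine (exp_le_two_rpow (by positivity)).trans
      (Real.rpow_le_rpow_of_exponent_le one_le_two ?_)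
    have h5 : (s : ℝ) + s' ≤ (1 + c) * s := by linarith
    have h6 := mul_le_mul_of_nonneg_left h5 (by positivity : 0 ≤ 8 * a)
    have h7 : 8 * a * ((1 + c) * s) = η / 2 * s := by rw [ha]; field_simp; norm_num
    linarith
  have e2 : (2 : ℝ) ^ (η * s) = 2 ^ (η / 4 * s) * (2 ^ (η / 4 * s) * 2 ^ (η / 2 * s)) := by
    rw [← Real.rpow_add two_pos, ← Real.rpow_add two_pos]
    congr 1
    ring
  rw [e2]
  exact mul_le_mul b1 (mul_le_mul b2 b3 (by positivity) (by positivity)) (by positivity)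
    (by positivity)

lemma card_smallSumsetPairs_le_two_rpow {G : Type*} [AddCommGroup G] [DecidableEq G]
    (Y : Finset G) (m s s' : ℕ) :
    ((smallSumsetPairs Y m s s').card : ℝ) ≤ (2 : ℝ) ^ (2 * Y.card : ℝ) := by
  have h1 : (smallSumsetPairs Y m s s').card ≤ 2 ^ (2 * Y.card) := by
    refine (Finset.card_filter_le _ _).trans ?_
    rw [Finset.card_product, Finset.card_powersetCard, Finset.card_powersetCard, two_mul, pow_add]
    exact Nat.mul_le_mul (Nat.choose_le_two_pow _ _) (Nat.choose_le_two_pow _ _)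
  calc ((smallSumsetPairs Y m s s').card : ℝ) ≤ (2 : ℝ) ^ (2 * Y.card) := by exact_mod_cast h1
    _ = _ := by rw [← Real.rpow_natCast]; push_cast; rfl

lemma le_add_mul_div {m a b x : ℝ} (ha : 0 ≤ a) (hab : 0 < a + b) (h : a + b ≤ m) (hx : 0 ≤ x) :
    a ≤ (m + x) * a / (a + b) := by
  rw [le_div_iff₀ hab, mul_comm]
  exact mul_le_mul_of_nonneg_right (by linarith) ha

end Counting

theorem theorem1p5 (m s s' : ℕ → ℕ)
    (hpos : ∀ n : ℕ, 1 ≤ n → 1 ≤ m n ∧ 1 ≤ s n ∧ 1 ≤ s' n)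
    (hss' : (fun n : ℕ => (s' n : ℝ)) =Θ[atTop] (fun n : ℕ => (s n : ℝ)))
    (hm_lower : ∀ n : ℕ, 1 ≤ n → s n + s' n ≤ m n)
    (hm_upper : (fun n : ℕ => (m n : ℝ)) =o[atTop]
      (fun n : ℕ => (s n : ℝ) ^ 2 / (Real.logb 2 (n : ℝ)) ^ 2)) :
    ∃ f g : ℕ → ℝ,
      f =o[atTop] (fun n : ℕ => (s n : ℝ)) ∧
      g =o[atTop] (fun n : ℕ => (m n : ℝ)) ∧
      ∀ n : ℕ, 1 ≤ n →
        ∀ (G : Type*) [AddCommGroup G] [DecidableEq G] (Y : Finset G), Y.card = n →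
          ((smallSumsetPairs Y (m n) (s n) (s' n)).card : ℝ) ≤
            (2 : ℝ) ^ (f n) *
              realChoose
                (((m n : ℝ) + (maxSubgroupSize G ((m n : ℝ) + g n) : ℝ)) * (s n : ℝ) /
                  ((s n : ℝ) + (s' n : ℝ))) (s n) *
              realChoose
                (((m n : ℝ) + (maxSubgroupSize G ((m n : ℝ) + g n) : ℝ)) * (s' n : ℝ) /
                  ((s n : ℝ) + (s' n : ℝ))) (s' n) := by
  classical
  obtain ⟨e, he, he0, hev⟩ := exists_tendsto_zero_of_eventually fun η hη hη1 =>
    eventually_card_smallSumsetPairs_le m s s' hpos hss' hm_lower hm_upper hη hη1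
  obtain ⟨N, hN⟩ := eventually_atTop.1 hev
  have hlittle : ∀ u : ℕ → ℕ, (fun n => e n * u n) =o[atTop] fun n => (u n : ℝ) := fun u => by
    simpa using ((isLittleO_one_iff ℝ).2 he).mul_isBigO (isBigO_refl (fun n => (u n : ℝ)) atTop)
  -- For the finitely many n below N, the trivial bound 4^n suffices: s + s' ≤ m makes both upper
  -- entries at least the lower ones, so the binomials are at least 1.
  refine ⟨fun n => if N ≤ n then e n * s n else 2 * n, fun n => e n * m n, ?_, hlittle m, ?_⟩
  · refine (hlittle s).congr' ?_ EventuallyEq.rfl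
    filter_upwards [eventually_ge_atTop N] with n hn
    rw [if_pos hn]
  · intro n hn G _ _ Y hY
    dsimp only
    split_ifs with h
    · exact hN n h G Y hY
    · obtain ⟨-, hs1, hs1'⟩ := hpos n hn
      have hs : (1 : ℝ) ≤ s n := by exact_mod_cast hs1
      have hs' : (1 : ℝ) ≤ s' n := by exact_mod_cast hs1'
      have hm : (s n : ℝ) + s' n ≤ m n := by exact_mod_cast hm_lower n hn
      have h1 := one_le_realChoose (le_add_mul_div (x := maxSubgroupSize G ((m n : ℝ) + e n * m n))
        (by linarith : (0 : ℝ) ≤ s n) (by linarith) hm (by positivity))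
      have h2 := one_le_realChoose (le_add_mul_div (x := maxSubgroupSize G ((m n : ℝ) + e n * m n))
        (by linarith : (0 : ℝ) ≤ s' n) (by linarith) (by linarith : (s' n : ℝ) + s n ≤ m n)
        (by positivity))
      rw [add_comm (s' n : ℝ)] at h2
      refine (card_smallSumsetPairs_le_two_rpow Y _ _ _).trans ?_
      rw [hY, mul_assoc]
      exact le_mul_of_one_le_right (by positivity) (one_le_mul_of_one_le_of_one_le h1 h2)
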